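/- **Theorem (asymptotic normality of $\widehat\lambda$ for the fractional linear birth–death process).** Let $\alpha\in(0,1]$, $\lambda>0$, $\mu>0$, $\theta=\lambda+\mu$, $p=\lambda/\theta$, and let $\gamma$ be Euler's constant. For the fractional linear birth–death process of order $\alpha$ with birth and death rates $\lambda k,\mu k$, let $S_k^\alpha$ be the sojourn time in state $k$, which is Mittag-Leffler distributed, $$\Pr\{S_k^\alpha\ge t\}=E_{\alpha,1}(-\theta k t^\alpha)\quad(t\ge 0),\qquad E_{\alpha,1}(z)=\sum_{j\ge0}\frac{z^j}{\Gamma(\alpha j+1)} ,$$ and suppose that the sojourn in state $k$ ends, independently of its length, with a birth (a move to $k+1$) with probability $p$ and with a death (a move to $k-1$) with probability $1-p$. A sample of size $n$ consists of independent transitions of this kind, one out of each of the states $k=1,\dots,n$; let $n_B$ be its number of births. Put $y_k=\ln S_k^\alpha$, $\overline{\ln k}=\frac1n\sum_{j=1}^n\ln j$, $\overline y=\frac1n\sum_{j=1}^n y_j$, $s=\sum_{j=1}^n(\ln j-\overline{\ln k})^2$, and define the least squares estimators $$\widehat b_1=\frac1s\sum_{j=1}^n y_j(\ln j-\overline{\ln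 k}),\qquad \widehat b_0=\overline y-\widehat b_1\,\overline{\ln k},$$ the residuals $\widehat\varepsilon_k=y_k-\widehat b_0-\widehat b_1\ln k$, $\widehat\sigma_\varepsilon^2=\frac1{n-2}\sum_{k=1}^n\widehat\varepsilon_k^{\,2}$, and the estimators $$\widehat\alpha=\Bigl[3\Bigl(\frac{\widehat\sigma_\varepsilon^2}{\pi^2}+\frac16\Bigr)\Bigr]^{-1/2},\qquad \widehat\theta=\exp\bigl(-\widehat\alpha(\widehat b_0+\gamma)\bigr),\qquad \widehat p=\frac{n_B}n,\qquad \widehat\lambda=\widehat p\,\widehat\theta .$$ Let $b_0=-\frac{\ln\theta}{\alpha}-\gamma$, $\sigma_\varepsilon^2=\pi^2\bigl(\frac1{3\alpha^2}-\frac16\bigr)$ and $$\sigma_\theta^2=\sigma_\theta^2(n)=e^{-2\alpha(b_0+\gamma)}\left[(b_0+\gamma)^2\,\frac{\alpha^2(32-20\alpha^2-\alpha^4)}{40}+n\,\alpha^2\sigma_\varepsilon^2\left(\frac1n+\frac{\overline{\ln k}^{\,2}}{s}\right)\right].$$ Then $\widehat\lambda$ is asymptotically normal, $\sqrt n(\widehat\lambda-\lambda)$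 being asymptotically $N\bigl(0,\theta^2p(1-p)+p^2\sigma_\theta^2\bigr)$. Since $\sigma_\theta^2$ depends on $n$, this means $$\frac{\sqrt n\,(\widehat\lambda-\lambda)}{\sqrt{\theta^2p(1-p)+p^2\sigma_\theta^2(n)}}\ \xrightarrow{\ d\ }\ N(0,1)\qquad(n\to\infty).$$ -/

import Mathlib

open MeasureTheory ProbabilityTheory Filter Topology

noncomputable section

namespace FracBD

/-- The one-parameter Mittag-Leffler function `E_{α,1}(z) = ∑_j z ^ j / Γ(α j + 1)`
(the series converges for every real `z` when `α > 0`). -/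
def mittagLeffler (α z : ℝ) : ℝ := ∑' j : ℕ, z ^ j / Real.Gamma (α * j + 1)

/-- The random time `S` is Mittag-Leffler distributed with order `α` and rate `r`:
`P (S ≥ t) = E_{α,1}(- r t ^ α)` for every `t ≥ 0`. (At `t = 0` this says that `S ≥ 0` almost
surely; for `α = 1` it is the exponential distribution of rate `r`.) -/
def IsMittagLeffler {Ω : Type*} [MeasurableSpace Ω] (P : Measure Ω) (S : Ω → ℝ) (α r : ℝ) : Prop :=
  ∀ t : ℝ, 0 ≤ t → P.real {ω | t ≤ S ω} = mittagLeffler α (-(r * t ^ α))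

/-- A sample of transitions of the fractional linear birth-death process of order `α`, birth
intensity `lam` and death intensity `mu`, one transition out of each of the states `1, 2, 3, …`.

`S k` is the sojourn time in the state `k + 1` and `J k` is the neighbouring state which is entered
at the end of that sojourn: `k + 2` for a birth and `k` for a death. -/
structure IsSample {Ω : Type*} [MeasurableSpace Ω] (P : Measure Ω) (α lam mu : ℝ)
    (S : ℕ → Ω → ℝ) (J : ℕ → Ω → ℕ) : Prop where
  measurable_sojourn : ∀ k, Measurable (S k)
  measurable_next : ∀ k, Measurable (J k)
  sojourn_law : ∀ k : ℕ, IsMittagLeffler P (S k) α ((lam + mu) * ((k : ℝ) + 1))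
  birth_prob : ∀ k, P.real {ω | J k ω = k + 2} = lam / (lam + mu)
  death_prob : ∀ k, P.real {ω | J k ω = k} = mu / (lam + mu)
  indep_sojourn_next : ∀ k, IndepFun (S k) (J k) P
  indep_transitions : iIndepFun (fun k ω => (S k ω, J k ω)) P

/-! ### The regression design -/

/-- The regressor: the logarithm of the state `k + 1`. -/
def logState (k : ℕ) : ℝ := Real.log ((k : ℝ) + 1)

/-- The mean of `ln 1, …, ln n`. -/
def logMean (n : ℕ) : ℝ := (∑ k ∈ Finset.range n, logState k) / n

/-- The sum of squares `s` of the deviations of `ln 1, …, ln n` from their mean. -/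
def logSS (n : ℕ) : ℝ := ∑ k ∈ Finset.range n, (logState k - logMean n) ^ 2

/-! ### The estimators, as functions of the observed sojourn times and transitions

Here `S k` is the observed sojourn time in the state `k + 1`, and `J k` the state entered next. -/

/-- The mean of the log-transformed sojourn times `ln S`. -/
def obsMean (n : ℕ) (S : ℕ → ℝ) : ℝ := (∑ k ∈ Finset.range n, Real.log (S k)) / n

/-- The least squares estimator of the slope. -/
def slopeHat (n : ℕ) (S : ℕ → ℝ) : ℝ :=
  (∑ k ∈ Finset.range n, Real.log (S k) * (logState k - logMean n)) / logSS n

/-- The least squares estimator of the intercept. -/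
def interceptHat (n : ℕ) (S : ℕ → ℝ) : ℝ := obsMean n S - slopeHat n S * logMean n

/-- The residual of the observation in the state `k + 1`. -/
def residual (n : ℕ) (S : ℕ → ℝ) (k : ℕ) : ℝ :=
  Real.log (S k) - (interceptHat n S + slopeHat n S * logState k)

/-- The residual variance estimator `∑ ε̂ ^ 2 / (n - 2)`. -/
def errVarHat (n : ℕ) (S : ℕ → ℝ) : ℝ :=
  (∑ k ∈ Finset.range n, residual n S k ^ 2) / ((n : ℝ) - 2)

/-- The residual-based estimator of `α`. -/
def alphaHat (n : ℕ) (S : ℕ → ℝ) : ℝ :=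
  (3 * (errVarHat n S / Real.pi ^ 2 + 1 / 6)) ^ (-(1 / 2) : ℝ)

/-- The estimator of `θ = λ + μ`. -/
def thetaHat (n : ℕ) (S : ℕ → ℝ) : ℝ :=
  Real.exp (-alphaHat n S * (interceptHat n S + Real.eulerMascheroniConstant))

/-- The number `n_B` of births among the transitions out of the states `1, …, n`. -/
def births (n : ℕ) (J : ℕ → ℕ) : ℕ := {k ∈ Finset.range n | J k = k + 2}.card

/-- The proportion of births, `n_B / n`. -/
def pHat (n : ℕ) (J : ℕ → ℕ) : ℝ := (births n J : ℝ) / n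

/-- The estimator of the birth intensity. -/
def lamHat (n : ℕ) (S : ℕ → ℝ) (J : ℕ → ℕ) : ℝ := pHat n J * thetaHat n S

/-! ### The asymptotic variance -/

/-- The intercept `b₀` of the regression of `ln S` on the logarithm of the state. -/
def intercept (α θ : ℝ) : ℝ := -Real.log θ / α - Real.eulerMascheroniConstant

/-- The error variance `σ_ε ^ 2` of the regression. -/
def errVar (α : ℝ) : ℝ := Real.pi ^ 2 * (1 / (3 * α ^ 2) - 1 / 6)

/-- The quantity `σ_θ ^ 2`; it depends on the sample size `n` through the design. -/
def thetaVar (α θ : ℝ) (n : ℕ) : ℝ :=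
  Real.exp (-2 * α * (intercept α θ + Real.eulerMascheroniConstant)) *
    ((intercept α θ + Real.eulerMascheroniConstant) ^ 2 *
        (α ^ 2 * (32 - 20 * α ^ 2 - α ^ 4) / 40) +
      n * α ^ 2 * errVar α * (1 / n + logMean n ^ 2 / logSS n))

/-- The variance `θ ^ 2 p (1 - p) + p ^ 2 σ_θ ^ 2` with `θ = λ + μ` and `p = λ / θ`. -/
def lamVar (α lam mu : ℝ) (n : ℕ) : ℝ :=
  (lam + mu) ^ 2 * (lam / (lam + mu)) * (1 - lam / (lam + mu)) +
    (lam / (lam + mu)) ^ 2 * thetaVar α (lam + mu) n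

end FracBD

end

noncomputable section

namespace FracBD

/-! ### Moments of the logarithm of a Mittag-Leffler variable -/

section MittagLefflerMoments

open Set

variable {Ω : Type*} [MeasurableSpace Ω] {P : Measure Ω} [IsProbabilityMeasure P]
  {T : Ω → ℝ} {α : ℝ}

/-! The mean of the regressors `ln 1, …, ln n` grows like `ln n`, while `logSS n / n` stays between
two positive constants. Extrapolating the fitted line back to regressor value 0 is therefore costly:
the intercept estimator has variance `errVar α * interceptWeightSS n`, and `n * interceptWeightSS n`
diverges, at the order of `(ln n)^2` (`tendsto_mul_interceptWeightSS`). So `lamVar` tends to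
infinity, and only its leading term matters. The proportion of births and the residual variance have
L¹ errors of order `1/√n`, which vanish after multiplication by `√n / √(lamVar n)`. The normal limit
comes from the intercept alone, and neither a joint limit theorem nor any dependence between the
estimators has to be considered.

The intercept error is a linear combination of i.i.d. centred errors whose weights are uniformly
negligible against the root of their sum of squares (`abs_interceptWeight_div_le`), so a
characteristic function argument applies (`tendstoInDistribution_weighted_sum`). The passage to the
estimator of the birth intensity is a delta method in which `dslope` makes the linearization exact:
`standardizedLamHat_apply` writes the standardized estimator as a continuous function of the
normalized intercept error and of quantities converging in probability, and Slutsky's theorem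
concludes.

The errors are understood through a rate-one Mittag-Leffler variable `T`. Its Laplace transform is
`1 / (1 + u^α)`, whence `E T^(-s) = Γ(1 + s/α) Γ(1 - s/α) / Γ(1 + s)` for `0 < s < α`. The moment
generating function of `-ln T` is analytic at 0, and its first two derivatives there give mean `γ`
and variance `errVar α`. -/

lemma mittagLeffler_zero (α : ℝ) : mittagLeffler α 0 = 1 := by
  rw [mittagLeffler, tsum_eq_single 0]
  · simp
  · intro j hj
    simp [hj]

lemma IsMittagLeffler.ae_nonneg {r : ℝ} (hT : Measurable T) (hα : 0 < α)
    (h : IsMittagLeffler P T α r) : ∀ᵐ ω ∂P, 0 ≤ T ω := by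
  have h0 := h 0 le_rfl
  rw [Real.zero_rpow hα.ne', mul_zero, neg_zero, mittagLeffler_zero] at h0
  have h1 : P.real {ω | 0 ≤ T ω}ᶜ = 0 := by
    rw [probReal_compl_eq_one_sub (measurableSet_le measurable_const hT), h0, sub_self]
  rwa [measureReal_eq_zero_iff] at h1

lemma integral_Ioi_indicator_mul_exp {u x : ℝ} (hx : 0 ≤ x) :
    ∫ t in Ioi (0 : ℝ), {t : ℝ | t ≤ x}.indicator (fun t => u * Real.exp (-u * t)) t
      = 1 - Real.exp (-u * x) := by
  rw [setIntegral_indicator (show MeasurableSet {t : ℝ | t ≤ x} from measurableSet_Iic)]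
  have : Ioi (0 : ℝ) ∩ {t : ℝ | t ≤ x} = Ioc 0 x := rfl
  rw [this, ← intervalIntegral.integral_of_le hx]
  have hd : ∀ t ∈ uIcc 0 x, HasDerivAt (fun t => -Real.exp (-u * t)) (u * Real.exp (-u * t)) t := by
    intro t _
    have := (((hasDerivAt_id t).const_mul (-u)).exp).neg
    convert! this using 1
    simp
    ring
  rw [intervalIntegral.integral_eq_sub_of_hasDerivAt hd
    (Continuous.intervalIntegrable (by fun_prop) _ _)]
  simp
  ring

/-- The Laplace transform of a nonnegative random variable in terms of its survival function. -/
lemma one_sub_mgf_neg_eq_integral_survival (hT : Measurable T) (h0 : ∀ᵐ ω ∂P, 0 ≤ T ω) {u : ℝ}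
    (hu : 0 < u) :
    1 - mgf T P (-u) = ∫ t in Ioi (0 : ℝ), u * Real.exp (-u * t) * P.real {ω | t ≤ T ω} := by
  have hint : Integrable (fun ω => Real.exp (-u * T ω)) P := by
    refine Integrable.of_bound (by fun_prop) 1 ?_
    filter_upwards [h0] with ω hω
    rw [Real.norm_eq_abs, Real.abs_exp]
    exact Real.exp_le_one_iff.2 (by nlinarith)
  have h1 : 1 - mgf T P (-u) = ∫ ω, (∫ t in Ioi (0 : ℝ),
      {t : ℝ | t ≤ T ω}.indicator (fun t => u * Real.exp (-u * t)) t) ∂P := by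
    have : ∀ᵐ ω ∂P, ∫ t in Ioi (0 : ℝ),
      {t : ℝ | t ≤ T ω}.indicator (fun t => u * Real.exp (-u * t)) t
        = 1 - Real.exp (-u * T ω) := by
      filter_upwards [h0] with ω hω using integral_Ioi_indicator_mul_exp hω
    rw [integral_congr_ae this, integral_sub (integrable_const _) hint]
    simp [mgf]
  have hmeas : MeasurableSet {x : Ω × ℝ | x.2 ≤ T x.1} :=
    measurableSet_le measurable_snd (hT.comp measurable_fst)
  have hexp : Integrable (fun t => u * Real.exp (-u * t)) (volume.restrict (Ioi (0 : ℝ))) :=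
    (integrableOn_exp_mul_Ioi (by linarith) 0).const_mul u
  rw [h1, integral_integral_swap]
  · refine integral_congr_ae (ae_of_all _ fun t => ?_)
    have : ∀ ω, {t : ℝ | t ≤ T ω}.indicator (fun t => u * Real.exp (-u * t)) t
        = {ω | t ≤ T ω}.indicator (fun _ => u * Real.exp (-u * t)) ω := by
      intro ω
      simp [indicator]
    simp only [this]
    rw [integral_indicator_const _ (measurableSet_le measurable_const hT), smul_eq_mul, mul_comm]
  · have hd : Integrable (fun x : Ω × ℝ => u * Real.exp (-u * x.2))
        (P.prod (volume.restrict (Ioi (0 : ℝ)))) := hexp.comp_snd P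
    refine (hd.indicator hmeas).congr (ae_of_all _ fun x => ?_)
    simp [Function.uncurry, indicator]

/-- Termwise integration: each term is a Gamma integral that cancels the coefficient of the series,
leaving a geometric series of ratio `-u^(-α)`. Absolute convergence is what requires `u > 1`. -/
lemma integral_exp_mul_mittagLeffler (hα : 0 < α) {u : ℝ} (hu : 1 < u) :
    ∫ t in Ioi (0 : ℝ), u * Real.exp (-u * t) * mittagLeffler α (-(t ^ α))
      = (1 + u ^ (-α))⁻¹ := by
  have hu0 : 0 < u := by linarith
  set F : ℕ → ℝ → ℝ := fun j t =>
    u * Real.exp (-u * t) * ((-(t ^ α)) ^ j / Real.Gamma (α * j + 1)) with hF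
  have hG : ∀ j : ℕ, 0 < Real.Gamma (α * j + 1) := fun j => Real.Gamma_pos_of_pos (by positivity)
  have hbase : ∀ j : ℕ, ∫ t in Ioi (0 : ℝ), u / Real.Gamma (α * j + 1) *
      (t ^ ((α * j + 1) - 1) * Real.exp (-(u * t))) = (u ^ (-α)) ^ j := by
    intro j
    rw [integral_const_mul, Real.integral_rpow_mul_exp_neg_mul_Ioi (by positivity) hu0,
      one_div, Real.inv_rpow hu0.le, Real.rpow_add hu0, Real.rpow_mul hu0.le, Real.rpow_natCast,
      Real.rpow_neg hu0.le, Real.rpow_one, inv_pow]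
    have := (hG j).ne'
    have := Real.rpow_pos_of_pos hu0 α
    field_simp
  have hint : ∀ j : ℕ, IntegrableOn (fun t : ℝ => u / Real.Gamma (α * j + 1) *
      (t ^ ((α * j + 1) - 1) * Real.exp (-(u * t)))) (Ioi 0) := by
    intro j
    -- A non-integrable function has Bochner integral 0, so the nonzero value computed in `hbase`
    -- yields integrability.
    refine Integrable.of_integral_ne_zero ?_
    rw [hbase]
    positivity
  have hFeq : ∀ j : ℕ, ∀ t ∈ Ioi (0 : ℝ), F j t = (-1) ^ j * (u / Real.Gamma (α * j + 1) *
      (t ^ ((α * j + 1) - 1) * Real.exp (-(u * t)))) := by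
    intro j t ht
    have ht' : (0 : ℝ) ≤ t := le_of_lt ht
    simp only [hF]
    rw [add_sub_cancel_right, Real.rpow_mul ht', Real.rpow_natCast, neg_pow (t ^ α), neg_mul]
    ring
  have hx : u ^ (-α) < 1 := Real.rpow_lt_one_of_one_lt_of_neg hu (by linarith)
  have hx0 : 0 < u ^ (-α) := Real.rpow_pos_of_pos hu0 _
  have hFint : ∀ j, IntegrableOn (F j) (Ioi 0) := fun j =>
    IntegrableOn.congr_fun ((hint j).const_mul ((-1) ^ j)) (fun t ht => (hFeq j t ht).symm)
      measurableSet_Ioi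
  have hval : ∀ j, ∫ t in Ioi (0 : ℝ), F j t = (-(u ^ (-α))) ^ j := by
    intro j
    rw [setIntegral_congr_fun measurableSet_Ioi (hFeq j), integral_const_mul, hbase,
      neg_pow (u ^ (-α))]
  have hnorm : ∀ j, ∫ t in Ioi (0 : ℝ), ‖F j t‖ = (u ^ (-α)) ^ j := by
    intro j
    rw [← hbase]
    refine setIntegral_congr_fun measurableSet_Ioi fun t ht => ?_
    have := hG j
    have ht' : 0 < t := ht
    simp only [hFeq j t ht, norm_mul, norm_pow, norm_neg, norm_one, one_pow, one_mul]
    rw [Real.norm_of_nonneg (by positivity), Real.norm_of_nonneg (by positivity),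
      Real.norm_of_nonneg (by positivity)]
  have hs : Summable fun j => ∫ t in Ioi (0 : ℝ), ‖F j t‖ := by
    simp_rw [hnorm]
    exact summable_geometric_of_lt_one hx0.le hx
  have key := hasSum_integral_of_summable_integral_norm hFint hs
  simp_rw [hval] at key
  have h2 := hasSum_geometric_of_abs_lt_one (r := -(u ^ (-α))) (by rwa [abs_neg, abs_of_pos hx0])
  rw [sub_neg_eq_add] at h2
  rw [h2.unique key]
  refine integral_congr_ae (ae_of_all _ fun t => ?_)
  simp only [hF, mittagLeffler]
  rw [tsum_mul_left]

/-- The series only reaches `u > 1`. Both sides are real analytic on the open negative half-line, so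
agreement near `-2` propagates to all `u > 0`. -/
lemma IsMittagLeffler.mgf_neg (hT : Measurable T) (hα : 0 < α)
    (h : IsMittagLeffler P T α 1) {u : ℝ} (hu : 0 < u) : mgf T P (-u) = (1 + u ^ α)⁻¹ := by
  have h0 := h.ae_nonneg hT hα
  have hset : Iio (0 : ℝ) ⊆ interior (integrableExpSet T P) := by
    refine interior_maximal (fun v hv => ?_) isOpen_Iio
    refine Integrable.of_bound (by fun_prop) 1 ?_
    filter_upwards [h0] with ω hω
    rw [Real.norm_eq_abs, Real.abs_exp]
    exact Real.exp_le_one_iff.2 (mul_nonpos_of_nonpos_of_nonneg (le_of_lt hv) hω)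
  have hf : AnalyticOnNhd ℝ (mgf T P) (Iio 0) := analyticOnNhd_mgf.mono hset
  have hg : AnalyticOnNhd ℝ (fun v : ℝ => (1 + (-v) ^ α)⁻¹) (Iio 0) := by
    intro v hv
    have hv' : 0 < -v := by simpa using hv
    have h1 : AnalyticAt ℝ (fun v : ℝ => (-v) ^ α) v := by
      have h2 : AnalyticAt ℝ (fun v : ℝ => Real.exp (Real.log (-v) * α)) v :=
        ((analyticAt_id.neg.log hv').mul analyticAt_const).rexp
      refine h2.congr ?_
      filter_upwards [Iio_mem_nhds hv] with w hw
      rw [Real.rpow_def_of_pos (by simpa using hw)]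
    exact (analyticAt_const.add h1).inv (by have := Real.rpow_pos_of_pos hv' α; simp; positivity)
  have hev : mgf T P =ᶠ[𝓝 (-2)] (fun v => (1 + (-v) ^ α)⁻¹) := by
    filter_upwards [Iio_mem_nhds (show (-2 : ℝ) < -1 by norm_num)] with v hv
    obtain ⟨w, rfl⟩ : ∃ w, v = -w := ⟨-v, by ring⟩
    have hw : 1 < w := by simpa using hv
    have hw0 : 0 < w := by linarith
    have e1 := one_sub_mgf_neg_eq_integral_survival hT h0 hw0
    have e2 : ∫ t in Ioi (0 : ℝ), w * Real.exp (-w * t) * P.real {ω | t ≤ T ω} =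
        ∫ t in Ioi (0 : ℝ), w * Real.exp (-w * t) * mittagLeffler α (-(t ^ α)) := by
      refine setIntegral_congr_fun measurableSet_Ioi fun t ht => ?_
      have := h t (le_of_lt ht)
      simp only [one_mul] at this
      simp only [this]
    rw [e2, integral_exp_mul_mittagLeffler hα hw, Real.rpow_neg hw0.le] at e1
    have := Real.rpow_pos_of_pos hw0 α
    rw [neg_neg, show mgf T P (-w) = 1 - (1 + (w ^ α)⁻¹)⁻¹ by linarith]
    field_simp
    ring
  have := hf.eqOn_of_preconnected_of_eventuallyEq hg isPreconnected_Iio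
    (show (-2 : ℝ) ∈ Iio 0 by norm_num) hev (show -u ∈ Iio (0 : ℝ) by simpa using hu)
  simpa using this

/-- Chernoff's bound at level 0 gives `P(T ≤ 0) ≤ 1 / (1 + u^α)`; let `u → ∞`. This excludes the
default values of `Real.log` and of negative powers at 0. -/
lemma IsMittagLeffler.ae_pos (hT : Measurable T) (hα : 0 < α)
    (h : IsMittagLeffler P T α 1) : ∀ᵐ ω ∂P, 0 < T ω := by
  have h0 := h.ae_nonneg hT hα
  have hle : ∀ u : ℝ, 0 < u → P.real {ω | T ω ≤ 0} ≤ (1 + u ^ α)⁻¹ := by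
    intro u hu
    rw [← h.mgf_neg hT hα hu]
    have hint : Integrable (fun ω => Real.exp (-u * T ω)) P := by
      refine Integrable.of_bound (by fun_prop) 1 ?_
      filter_upwards [h0] with ω hω
      rw [Real.norm_eq_abs, Real.abs_exp]
      exact Real.exp_le_one_iff.2 (by nlinarith)
    have := measure_le_le_exp_mul_mgf (X := T) (μ := P) 0 (t := -u) (by linarith) hint
    simpa using this
  have hlim : Tendsto (fun u : ℝ => (1 + u ^ α)⁻¹) atTop (𝓝 0) :=
    tendsto_inv_atTop_zero.comp (tendsto_atTop_add_const_left _ _ (tendsto_rpow_atTop hα))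
  have hz : P.real {ω | T ω ≤ 0} = 0 := by
    refine le_antisymm (ge_of_tendsto hlim ?_) measureReal_nonneg
    filter_upwards [eventually_gt_atTop 0] with u hu using hle u hu
  rw [measureReal_eq_zero_iff] at hz
  rw [ae_iff]
  simpa using hz

lemma lintegral_ofReal_of_integral_eq {β : Type*} [MeasurableSpace β] {μ : Measure β} {f : β → ℝ}
    {c : ℝ} (hf : 0 ≤ᵐ[μ] f) (hc : 0 < c) (h : ∫ x, f x ∂μ = c) :
    ∫⁻ x, ENNReal.ofReal (f x) ∂μ = ENNReal.ofReal c := by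
  rw [← ofReal_integral_eq_lintegral_ofReal (Integrable.of_integral_ne_zero (h ▸ hc.ne')) hf, h]

/-- Write `1 / (1 + u^α)` as the integral of `exp(-w (1 + u^α))` over `w > 0` and apply Tonelli;
both remaining integrals are Gamma integrals. Lower integrals spare integrability conditions and
later deliver integrability of `T^(-s)`. -/
lemma lintegral_rpow_mul_inv_one_add_rpow {s : ℝ} (hs : 0 < s) (hsα : s < α) :
    ∫⁻ u in Ioi (0 : ℝ), ENNReal.ofReal (u ^ (s - 1) * (1 + u ^ α)⁻¹)
      = ENNReal.ofReal (Real.Gamma (s / α) * Real.Gamma (1 - s / α) / α) := by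
  have hα : 0 < α := hs.trans hsα
  have hq : s / α < 1 := (div_lt_one hα).2 hsα
  have hG1 : 0 < Real.Gamma (s / α) := Real.Gamma_pos_of_pos (by positivity)
  have hG2 : 0 < Real.Gamma (1 - s / α) := Real.Gamma_pos_of_pos (by linarith)
  have h1 : ∀ u ∈ Ioi (0 : ℝ), ENNReal.ofReal (u ^ (s - 1) * (1 + u ^ α)⁻¹) =
      ∫⁻ w in Ioi (0 : ℝ), ENNReal.ofReal (u ^ (s - 1) * Real.exp (-w * u ^ α) * Real.exp (-w)) := by
    intro u hu
    have hu0 : (0 : ℝ) < u := hu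
    have hua := Real.rpow_pos_of_pos hu0 α
    have hus := Real.rpow_pos_of_pos hu0 (s - 1)
    rw [lintegral_ofReal_of_integral_eq (c := u ^ (s - 1) * (1 + u ^ α)⁻¹)]
    · exact ae_of_all _ fun w => by positivity
    · positivity
    · have : ∀ w : ℝ, u ^ (s - 1) * Real.exp (-w * u ^ α) * Real.exp (-w) =
          u ^ (s - 1) * (w ^ ((1 : ℝ) - 1) * Real.exp (-((1 + u ^ α) * w))) := by
        intro w
        rw [mul_assoc, ← Real.exp_add, sub_self, Real.rpow_zero, one_mul]
        ring_nf
      simp_rw [this]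
      rw [integral_const_mul, Real.integral_rpow_mul_exp_neg_mul_Ioi one_pos (by positivity),
        Real.rpow_one, Real.Gamma_one, one_div, mul_one]
  rw [setLIntegral_congr_fun measurableSet_Ioi h1, lintegral_lintegral_swap (by fun_prop)]
  have h2 : ∀ w ∈ Ioi (0 : ℝ), ∫⁻ u in Ioi (0 : ℝ),
      ENNReal.ofReal (u ^ (s - 1) * Real.exp (-w * u ^ α) * Real.exp (-w)) =
      ENNReal.ofReal (Real.Gamma (s / α) / α *
        (w ^ ((1 - s / α) - 1) * Real.exp (-(1 * w)))) := by
    intro w hw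
    have hw0 : (0 : ℝ) < w := hw
    rw [lintegral_ofReal_of_integral_eq]
    · filter_upwards [ae_restrict_mem measurableSet_Ioi] with u hu
      have hu0 : (0 : ℝ) < u := hu
      simp only [Pi.zero_apply]
      positivity
    · positivity
    · rw [integral_mul_const, integral_rpow_mul_exp_neg_mul_rpow hα (by linarith) hw0]
      rw [show -(s - 1 + 1) / α = 1 - s / α - 1 by ring, show (s - 1 + 1) / α = s / α by ring]
      ring_nf
  rw [setLIntegral_congr_fun measurableSet_Ioi h2, lintegral_ofReal_of_integral_eq]
  · filter_upwards [ae_restrict_mem measurableSet_Ioi] with u hu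
    have hu0 : (0 : ℝ) < u := hu
    simp only [Pi.zero_apply]
    positivity
  · positivity
  · rw [integral_const_mul, Real.integral_rpow_mul_exp_neg_mul_Ioi (by linarith) one_pos]
    simp
    ring

/-- `Γ(s) T^(-s)` is the integral of `u^(s-1) exp(-T u)` over `u > 0`; Tonelli turns its expectation
into a Mellin transform of the Laplace transform. -/
lemma IsMittagLeffler.lintegral_rpow_neg (hT : Measurable T) (hα : 0 < α)
    (h : IsMittagLeffler P T α 1) {s : ℝ} (hs : 0 < s) (hsα : s < α) :
    ∫⁻ ω, ENNReal.ofReal (T ω ^ (-s) * Real.Gamma s) ∂P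
      = ENNReal.ofReal (Real.Gamma (s / α) * Real.Gamma (1 - s / α) / α) := by
  have hG := Real.Gamma_pos_of_pos hs
  have hpos := h.ae_pos hT hα
  rw [← lintegral_rpow_mul_inv_one_add_rpow hs hsα]
  have h1 : ∀ᵐ ω ∂P, ENNReal.ofReal (T ω ^ (-s) * Real.Gamma s) =
      ∫⁻ u in Ioi (0 : ℝ), ENNReal.ofReal (u ^ (s - 1) * Real.exp (-(T ω * u))) := by
    filter_upwards [hpos] with ω hω
    rw [lintegral_ofReal_of_integral_eq]
    · filter_upwards [ae_restrict_mem measurableSet_Ioi] with u hu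
      have hu0 : (0 : ℝ) < u := hu
      simp only [Pi.zero_apply]
      positivity
    · positivity
    · rw [Real.integral_rpow_mul_exp_neg_mul_Ioi hs hω, one_div, Real.inv_rpow hω.le,
        Real.rpow_neg hω.le]
  rw [lintegral_congr_ae h1, lintegral_lintegral_swap (by fun_prop)]
  refine setLIntegral_congr_fun measurableSet_Ioi fun u hu => ?_
  have hu0 : (0 : ℝ) < u := hu
  have hua := Real.rpow_pos_of_pos hu0 α
  have hus := Real.rpow_pos_of_pos hu0 (s - 1)
  refine lintegral_ofReal_of_integral_eq (ae_of_all _ fun ω => by positivity) (by positivity) ?_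
  rw [integral_const_mul, ← h.mgf_neg hT hα hu0, mgf]
  simp_rw [neg_mul, mul_comm]

lemma IsMittagLeffler.exp_neg_log_ae_eq (hT : Measurable T) (hα : 0 < α)
    (h : IsMittagLeffler P T α 1) (s : ℝ) :
    (fun ω => Real.exp (s * -Real.log (T ω))) =ᵐ[P] fun ω => T ω ^ (-s) := by
  filter_upwards [h.ae_pos hT hα] with ω hω
  rw [Real.rpow_def_of_pos hω]
  ring_nf

lemma IsMittagLeffler.integrable_rpow_neg (hT : Measurable T) (hα : 0 < α)
    (h : IsMittagLeffler P T α 1) {s : ℝ} (hs : 0 < s) (hsα : s < α) :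
    Integrable (fun ω => T ω ^ (-s)) P := by
  have hG := Real.Gamma_pos_of_pos hs
  have : Integrable (fun ω => T ω ^ (-s) * Real.Gamma s) P := by
    refine ⟨((hT.pow_const _).mul_const _).aestronglyMeasurable, ?_⟩
    rw [hasFiniteIntegral_iff_ofReal, h.lintegral_rpow_neg hT hα hs hsα]
    · exact ENNReal.ofReal_lt_top
    · filter_upwards [h.ae_pos hT hα] with ω hω
      simp only [Pi.zero_apply]
      positivity
  simpa [mul_assoc, hG.ne'] using this.mul_const (Real.Gamma s)⁻¹

lemma IsMittagLeffler.mgf_neg_log_mul_Gamma (hT : Measurable T) (hα : 0 < α)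
    (h : IsMittagLeffler P T α 1) {s : ℝ} (hs : 0 < s) (hsα : s < α) :
    mgf (fun ω => -Real.log (T ω)) P s * Real.Gamma (1 + s) =
      Real.Gamma (1 + s / α) * Real.Gamma (1 - s / α) := by
  have hq : s / α < 1 := (div_lt_one hα).2 hsα
  have hG := Real.Gamma_pos_of_pos hs
  have hG1 : 0 < Real.Gamma (s / α) := Real.Gamma_pos_of_pos (by positivity)
  have hG2 : 0 < Real.Gamma (1 - s / α) := Real.Gamma_pos_of_pos (by linarith)
  have h1 : mgf (fun ω => -Real.log (T ω)) P s * Real.Gamma s =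
      Real.Gamma (s / α) * Real.Gamma (1 - s / α) / α := by
    rw [mgf, integral_congr_ae (h.exp_neg_log_ae_eq hT hα s), ← integral_mul_const,
      integral_eq_lintegral_of_nonneg_ae _
        ((hT.pow_const _).mul_const _).aestronglyMeasurable, h.lintegral_rpow_neg hT hα hs hsα,
      ENNReal.toReal_ofReal (by positivity)]
    filter_upwards [h.ae_pos hT hα] with ω hω
    simp only [Pi.zero_apply]
    positivity
  rw [add_comm 1 s, add_comm 1 (s / α), Real.Gamma_add_one hs.ne',
    Real.Gamma_add_one (by positivity : s / α ≠ 0)]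
  linear_combination s * h1

/-- Markov's inequality for `1 - exp(-T/t)`, which is at least `1 - exp(-1)` where `T ≥ t` and whose
mean the Laplace transform gives. -/
lemma IsMittagLeffler.tail_le (hT : Measurable T) (hα : 0 < α)
    (h : IsMittagLeffler P T α 1) {t : ℝ} (ht : 0 < t) :
    (1 - Real.exp (-1)) * P.real {ω | t ≤ T ω} ≤ t ^ (-α) := by
  have h0 := h.ae_nonneg hT hα
  have hu : 0 < t⁻¹ := by positivity
  have hint : Integrable (fun ω => Real.exp (-t⁻¹ * T ω)) P := by
    refine Integrable.of_bound (by fun_prop) 1 ?_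
    filter_upwards [h0] with ω hω
    rw [Real.norm_eq_abs, Real.abs_exp]
    exact Real.exp_le_one_iff.2 (by nlinarith)
  have hmark := mul_meas_ge_le_integral_of_nonneg (μ := P)
    (f := fun ω => 1 - Real.exp (-t⁻¹ * T ω)) (by
      filter_upwards [h0] with ω hω
      have : Real.exp (-t⁻¹ * T ω) ≤ 1 := Real.exp_le_one_iff.2 (by nlinarith)
      simpa using this) ((integrable_const 1).sub hint) (1 - Real.exp (-1))
  have hmgf := h.mgf_neg hT hα hu
  rw [mgf] at hmgf
  rw [integral_sub (integrable_const 1) hint, hmgf] at hmark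
  have hset : {ω | t ≤ T ω} ⊆ {ω | 1 - Real.exp (-1) ≤ 1 - Real.exp (-t⁻¹ * T ω)} := by
    intro ω (hω : t ≤ T ω)
    have : 1 ≤ t⁻¹ * T ω := by rw [inv_mul_eq_div]; exact (one_le_div ht).2 hω
    have : Real.exp (-t⁻¹ * T ω) ≤ Real.exp (-1) := Real.exp_le_exp.2 (by linarith)
    exact sub_le_sub_left this 1
  have he : 0 ≤ 1 - Real.exp (-1) := by
    have : Real.exp (-1) ≤ 1 := Real.exp_le_one_iff.2 (by norm_num)
    linarith
  have hta := Real.rpow_pos_of_pos ht α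
  calc _ ≤ _ := mul_le_mul_of_nonneg_left (measureReal_mono hset) he
    _ ≤ _ := hmark
    _ ≤ _ := by
      rw [Real.inv_rpow ht.le, Real.rpow_neg ht.le]
      simp only [integral_const, probReal_univ, smul_eq_mul, mul_one]
      field_simp
      linarith

/-- Layer-cake formula: the survival function is at most 1 on `(0, 1]`, and beyond 1 the tail bound
leaves the integrable power `t^(s-1-α)`. These moments supply the negative side of the neighbourhood
of 0 on which the moment generating function of `-ln T` is finite. -/
lemma IsMittagLeffler.integrable_rpow (hT : Measurable T) (hα : 0 < α)
    (h : IsMittagLeffler P T α 1) {s : ℝ} (hs : 0 < s) (hsα : s < α) :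
    Integrable (fun ω => T ω ^ s) P := by
  have h0 := h.ae_nonneg hT hα
  have he : 0 < 1 - Real.exp (-1) := by
    have : Real.exp (-1) < 1 := Real.exp_lt_one_iff.2 (by norm_num)
    linarith
  refine ⟨(hT.pow_const _).aestronglyMeasurable, ?_⟩
  rw [hasFiniteIntegral_iff_ofReal (by filter_upwards [h0] with ω hω using Real.rpow_nonneg hω _),
    lintegral_rpow_eq_lintegral_meas_le_mul P h0 hT.aemeasurable hs]
  refine ENNReal.mul_lt_top ENNReal.ofReal_lt_top ?_
  have hsplit : Ioi (0 : ℝ) = Ioc 0 1 ∪ Ioi 1 := (Ioc_union_Ioi_eq_Ioi zero_le_one).symm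
  rw [hsplit]
  refine (lintegral_union_le _ _ _).trans_lt (ENNReal.add_lt_top.2 ⟨?_, ?_⟩)
  · have hint : IntegrableOn (fun t : ℝ => t ^ (s - 1)) (Ioc 0 1) :=
      (intervalIntegrable_iff_integrableOn_Ioc_of_le zero_le_one).1
        (intervalIntegral.intervalIntegrable_rpow' (by linarith))
    refine lt_of_le_of_lt ?_ hint.lintegral_lt_top
    refine lintegral_mono fun t => ?_
    exact mul_le_of_le_one_left zero_le prob_le_one
  · have hint : IntegrableOn (fun t : ℝ => (1 - Real.exp (-1))⁻¹ * t ^ (s - 1 - α)) (Ioi 1) :=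
      (integrableOn_Ioi_rpow_of_lt (by linarith) one_pos).const_mul _
    refine lt_of_le_of_lt ?_ hint.lintegral_lt_top
    refine setLIntegral_mono' measurableSet_Ioi fun t ht => ?_
    have ht0 : 0 < t := one_pos.trans ht
    rw [← ofReal_measureReal, ← ENNReal.ofReal_mul measureReal_nonneg]
    refine ENNReal.ofReal_le_ofReal ?_
    have := h.tail_le hT hα ht0
    rw [sub_eq_add_neg (s - 1) α, Real.rpow_add ht0, mul_comm (t ^ (s - 1)), ← mul_assoc]
    gcongr
    rw [inv_mul_eq_div, le_div_iff₀' he]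
    exact this

lemma IsMittagLeffler.zero_mem_interior_integrableExpSet (hT : Measurable T) (hα : 0 < α)
    (h : IsMittagLeffler P T α 1) :
    0 ∈ interior (integrableExpSet (fun ω => -Real.log (T ω)) P) := by
  refine mem_interior.2 ⟨Ioo (-α) α, fun s hs => ?_, isOpen_Ioo, by simpa using hα⟩
  rw [integrableExpSet, mem_ofPred_eq, integrable_congr (h.exp_neg_log_ae_eq hT hα s)]
  rcases lt_trichotomy s 0 with h0 | h0 | h0
  · exact h.integrable_rpow hT hα (by linarith) (by linarith [hs.1])
  · simp [h0]
  · exact h.integrable_rpow_neg hT hα h0 hs.2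

/-! ### Derivatives of Gamma at 1, and the first two moments -/

lemma analyticAt_Gamma_one_add_zero : AnalyticAt ℝ (fun x : ℝ => Real.Gamma (1 + x)) 0 := by
  have h1 : AnalyticAt ℂ (fun z : ℂ => Complex.Gamma (1 + z)) ((0 : ℝ) : ℂ) := by
    rw [Complex.analyticAt_iff_eventually_differentiableAt]
    have : ∀ᶠ z : ℂ in 𝓝 ((0 : ℝ) : ℂ), 0 < (1 + z).re :=
      (by fun_prop : Continuous fun z : ℂ => (1 + z).re).continuousAt.eventually
        (lt_mem_nhds (by simp))
    filter_upwards [this] with z hz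
    refine DifferentiableAt.comp (g := Complex.Gamma) z
      (Complex.differentiableAt_Gamma _ fun m hm => ?_) (by fun_prop)
    rw [hm] at hz
    simp at hz
    linarith [(Nat.cast_nonneg m : (0 : ℝ) ≤ m)]
  refine h1.re_ofReal.congr (Eventually.of_forall fun x => ?_)
  simp only
  rw [← Complex.ofReal_one, ← Complex.ofReal_add, Complex.Gamma_ofReal, Complex.ofReal_re]

lemma iteratedDeriv_comp_mul_left (n : ℕ) (f : ℝ → ℝ) (c x : ℝ) :
    iteratedDeriv n (fun y => f (c * y)) x = c ^ n * iteratedDeriv n f (c * x) := by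
  induction n generalizing x with
  | zero => simp
  | succ n ih =>
    rw [iteratedDeriv_succ, funext ih, deriv_const_mul_field, deriv_comp_mul_left,
      iteratedDeriv_succ, pow_succ, smul_eq_mul]
    ring

lemma iteratedDeriv_one_Gamma_one_add :
    iteratedDeriv 1 (fun x : ℝ => Real.Gamma (1 + x)) 0 = -Real.eulerMascheroniConstant := by
  rw [iteratedDeriv_one]
  have : HasDerivAt Real.Gamma (-Real.eulerMascheroniConstant) (1 + 0) := by
    simpa using Real.hasDerivAt_Gamma_one
  exact (this.comp_const_add 1 0).deriv

lemma analyticAt_Gamma_one_add_mul_zero (c : ℝ) :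
    AnalyticAt ℝ (fun x : ℝ => Real.Gamma (1 + c * x)) 0 :=
  AnalyticAt.comp_of_eq (g := fun x : ℝ => Real.Gamma (1 + x)) (f := fun x => c * x) (y := 0)
    analyticAt_Gamma_one_add_zero (by fun_prop) (by simp)

lemma iteratedDeriv_one_Gamma_mul_Gamma (c : ℝ) :
    iteratedDeriv 1 (fun x : ℝ => Real.Gamma (1 + c * x) * Real.Gamma (1 + -c * x)) 0 = 0 := by
  rw [iteratedDeriv_fun_mul (analyticAt_Gamma_one_add_mul_zero c).contDiffAt
    (analyticAt_Gamma_one_add_mul_zero (-c)).contDiffAt]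
  simp only [iteratedDeriv_comp_mul_left _ (fun x : ℝ => Real.Gamma (1 + x))]
  simp [Finset.sum_range_succ]

lemma iteratedDeriv_two_Gamma_mul_Gamma (c : ℝ) :
    iteratedDeriv 2 (fun x : ℝ => Real.Gamma (1 + c * x) * Real.Gamma (1 + -c * x)) 0 =
      2 * c ^ 2 * (iteratedDeriv 2 (fun x : ℝ => Real.Gamma (1 + x)) 0
        - Real.eulerMascheroniConstant ^ 2) := by
  rw [iteratedDeriv_fun_mul (analyticAt_Gamma_one_add_mul_zero c).contDiffAt
    (analyticAt_Gamma_one_add_mul_zero (-c)).contDiffAt]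
  simp only [iteratedDeriv_comp_mul_left _ (fun x : ℝ => Real.Gamma (1 + x))]
  simp only [Finset.sum_range_succ, Finset.range_zero, Finset.sum_empty, mul_zero, zero_add,
    Nat.sub_zero, Nat.sub_self, Nat.add_one_sub_one, iteratedDeriv_one_Gamma_one_add]
  simp
  ring

/-- By the reflection formula, `Γ(1+x) Γ(1-x) sin(πx) = πx` near 0. Since the sine vanishes at 0,
the second derivative of the Gamma product first appears in the third derivative of this identity.
-/
lemma iteratedDeriv_two_Gamma_one_add :
    iteratedDeriv 2 (fun x : ℝ => Real.Gamma (1 + x)) 0 =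
      Real.eulerMascheroniConstant ^ 2 + Real.pi ^ 2 / 6 := by
  set F : ℝ → ℝ := fun x => Real.Gamma (1 + 1 * x) * Real.Gamma (1 + -1 * x) with hF
  have hFa : AnalyticAt ℝ F 0 :=
    (analyticAt_Gamma_one_add_mul_zero 1).mul (analyticAt_Gamma_one_add_mul_zero (-1))
  have hrefl : (fun x => F x * Real.sin (Real.pi * x)) =ᶠ[𝓝 0] fun x => Real.pi * x := by
    filter_upwards [Ioo_mem_nhds (show (-1 : ℝ) < 0 by norm_num) one_pos] with x hx
    rcases eq_or_ne x 0 with rfl | hx0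
    · simp
    · have hs : Real.sin (Real.pi * x) ≠ 0 := by
        rw [Real.sin_ne_zero_iff]
        intro n hn
        rw [mul_comm] at hn
        have hn' : (n : ℝ) = x := mul_left_cancel₀ Real.pi_ne_zero hn
        have h1 : (-1 : ℝ) < n := hn' ▸ hx.1
        have h2 : (n : ℝ) < 1 := hn' ▸ hx.2
        have h3 : -1 < n := by exact_mod_cast h1
        have h4 : n < 1 := by exact_mod_cast h2
        have : n = 0 := by omega
        rw [this] at hn'
        exact hx0 (by simpa using hn'.symm)
      have := Real.Gamma_mul_Gamma_one_sub x
      rw [hF]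
      simp only [one_mul, neg_mul]
      rw [add_comm 1 x, Real.Gamma_add_one hx0, ← sub_eq_add_neg, mul_assoc x, this,
        mul_assoc, div_mul_cancel₀ _ hs, mul_comm]
  have h3 := hrefl.iteratedDeriv_eq 3
  rw [iteratedDeriv_fun_mul hFa.contDiffAt (by fun_prop)] at h3
  simp only [iteratedDeriv_comp_mul_left _ Real.sin, iteratedDeriv_comp_mul_left _ (fun x => x)] at h3
  have hF0 : F 0 = 1 := by simp [hF]
  have hF2 := iteratedDeriv_two_Gamma_mul_Gamma 1
  rw [← hF] at hF2
  have hid : iteratedDeriv 3 (fun x : ℝ => x) 0 = 0 := by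
    simp [iteratedDeriv_succ]
  simp [Finset.sum_range_succ, hF0, hF2, hid] at h3
  have hpi := Real.pi_ne_zero
  have : Real.pi * (6 * (iteratedDeriv 2 (fun x : ℝ => Real.Gamma (1 + x)) 0 -
      Real.eulerMascheroniConstant ^ 2) - Real.pi ^ 2) = 0 := by linear_combination h3
  have := (mul_eq_zero.1 this).resolve_left hpi
  linarith

/-- The moment formula is available only for `0 < s < α`; analyticity of both sides at 0 extends it
to a two-sided neighbourhood, so that it can be differentiated at 0. -/
lemma IsMittagLeffler.mgf_neg_log_mul_Gamma_eventuallyEq (hT : Measurable T) (hα : 0 < α)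
    (h : IsMittagLeffler P T α 1) :
    (fun s => mgf (fun ω => -Real.log (T ω)) P s * Real.Gamma (1 + s)) =ᶠ[𝓝 0]
      fun s => Real.Gamma (1 + α⁻¹ * s) * Real.Gamma (1 + -α⁻¹ * s) := by
  have h1 : AnalyticAt ℝ (fun s => mgf (fun ω => -Real.log (T ω)) P s * Real.Gamma (1 + s)) 0 :=
    (analyticAt_mgf (h.zero_mem_interior_integrableExpSet hT hα)).mul analyticAt_Gamma_one_add_zero
  have h2 : AnalyticAt ℝ (fun s => Real.Gamma (1 + α⁻¹ * s) * Real.Gamma (1 + -α⁻¹ * s)) 0 :=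
    (analyticAt_Gamma_one_add_mul_zero _).mul (analyticAt_Gamma_one_add_mul_zero _)
  refine (h1.frequently_eq_iff_eventually_eq h2).1 ?_
  have h3 : ∃ᶠ s in 𝓝[>] (0 : ℝ), mgf (fun ω => -Real.log (T ω)) P s * Real.Gamma (1 + s) =
      Real.Gamma (1 + α⁻¹ * s) * Real.Gamma (1 + -α⁻¹ * s) := by
    refine Eventually.frequently ?_
    filter_upwards [Ioo_mem_nhdsGT hα] with s hs
    rw [h.mgf_neg_log_mul_Gamma hT hα hs.1 hs.2]
    ring_nf
  exact h3.filter_mono (nhdsWithin_mono _ fun x hx => ne_of_gt hx)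

/-- The Gamma product on the right is even in `s`, so its derivative at 0 vanishes; on the left the
derivative is the mean minus `γ`. -/
lemma IsMittagLeffler.integral_neg_log (hT : Measurable T) (hα : 0 < α)
    (h : IsMittagLeffler P T α 1) :
    ∫ ω, -Real.log (T ω) ∂P = Real.eulerMascheroniConstant := by
  have hi := h.zero_mem_interior_integrableExpSet hT hα
  have h1 := (h.mgf_neg_log_mul_Gamma_eventuallyEq hT hα).iteratedDeriv_eq 1
  rw [iteratedDeriv_one_Gamma_mul_Gamma, iteratedDeriv_fun_mul (analyticAt_mgf hi).contDiffAt
    analyticAt_Gamma_one_add_zero.contDiffAt] at h1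
  simp only [Finset.sum_range_succ, Finset.range_zero, Finset.sum_empty, Nat.sub_zero, Nat.sub_self,
    iteratedDeriv_one_Gamma_one_add, iteratedDeriv_mgf_zero hi, Pi.pow_apply] at h1
  simp at h1
  linarith

lemma IsMittagLeffler.integral_neg_log_sq (hT : Measurable T) (hα : 0 < α)
    (h : IsMittagLeffler P T α 1) :
    ∫ ω, (-Real.log (T ω)) ^ 2 ∂P = errVar α + Real.eulerMascheroniConstant ^ 2 := by
  have hi := h.zero_mem_interior_integrableExpSet hT hα
  have hm := h.integral_neg_log hT hα
  have h1 := (h.mgf_neg_log_mul_Gamma_eventuallyEq hT hα).iteratedDeriv_eq 2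
  rw [iteratedDeriv_two_Gamma_mul_Gamma, iteratedDeriv_fun_mul (analyticAt_mgf hi).contDiffAt
    analyticAt_Gamma_one_add_zero.contDiffAt] at h1
  simp only [Finset.sum_range_succ, Finset.range_zero, Finset.sum_empty, Nat.sub_zero, Nat.sub_self,
    Nat.add_one_sub_one, iteratedDeriv_one_Gamma_one_add, iteratedDeriv_two_Gamma_one_add,
    iteratedDeriv_mgf_zero hi, Pi.pow_apply, pow_one, hm] at h1
  simp at h1
  simp only [neg_sq, errVar]
  have : 1 / (3 * α ^ 2) = (α ^ 2)⁻¹ / 3 := by field_simp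
  rw [this]
  linear_combination h1

end MittagLefflerMoments

/-! ### A central limit theorem for weighted sums -/

section CentralLimit

variable {Ω : Type*} [MeasurableSpace Ω] {P : Measure Ω} [IsProbabilityMeasure P]

lemma norm_prod_sub_prod_le {ι : Type*} (s : Finset ι) (f g : ι → ℂ) (hf : ∀ i, ‖f i‖ ≤ 1)
    (hg : ∀ i, ‖g i‖ ≤ 1) : ‖∏ i ∈ s, f i - ∏ i ∈ s, g i‖ ≤ ∑ i ∈ s, ‖f i - g i‖ := by
  classical
  induction s using Finset.induction_on with
  | empty => simp
  | insert i s hi ih =>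
    rw [Finset.prod_insert hi, Finset.prod_insert hi, Finset.sum_insert hi]
    have h1 : ‖∏ i ∈ s, f i‖ ≤ 1 := by
      rw [norm_prod]
      exact Finset.prod_le_one (fun _ _ => norm_nonneg _) fun _ _ => hf _
    calc _ = ‖(f i - g i) * ∏ i ∈ s, f i + g i * (∏ i ∈ s, f i - ∏ i ∈ s, g i)‖ := by ring_nf
      _ ≤ ‖f i - g i‖ * ‖∏ i ∈ s, f i‖ + ‖g i‖ * ‖∏ i ∈ s, f i - ∏ i ∈ s, g i‖ := by
        rw [← norm_mul, ← norm_mul]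
        exact norm_add_le _ _
      _ ≤ ‖f i - g i‖ * 1 + 1 * ∑ i ∈ s, ‖f i - g i‖ := by
        gcongr
        exact hg i
      _ = _ := by ring

/-- Both functions are `1 - t²/2 + o(t²)`. -/
lemma isLittleO_charFun_sub_exp {X : Ω → ℝ} (hX : AEMeasurable X P) (h0 : P[X] = 0)
    (h1 : P[X ^ 2] = 1) :
    (fun t : ℝ => charFun (P.map X) t - Complex.exp (-t ^ 2 / 2)) =o[𝓝 0] fun t : ℝ => t ^ 2 := by
  have hφ := taylor_charFun_two hX h0 h1
  have hexp : (fun z : ℂ => Complex.exp z - (1 + z)) =o[𝓝 0] fun z => z := by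
    have := (hasDerivAt_iff_isLittleO.1 (Complex.hasDerivAt_exp 0))
    simpa [sub_sub] using this
  have hy : Tendsto (fun t : ℝ => (-t ^ 2 / 2 : ℂ)) (𝓝 0) (𝓝 0) := by
    have : Continuous fun t : ℝ => (-t ^ 2 / 2 : ℂ) := by fun_prop
    simpa using this.tendsto 0
  have h2 := hexp.comp_tendsto hy
  have h3 : (fun t : ℝ => (-t ^ 2 / 2 : ℂ)) =O[𝓝 0] fun t : ℝ => t ^ 2 := by
    refine Asymptotics.IsBigO.of_bound 1 (Eventually.of_forall fun t => ?_)
    simp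
    nlinarith [sq_nonneg t]
  refine (hφ.sub (h2.trans_isBigO h3)).congr_left fun t => ?_
  simp only [Function.comp]
  ring

/-- The central limit theorem for weighted sums of independent identically distributed variables
whose weights are uniformly negligible. -/
theorem tendstoInDistribution_weighted_sum {X : ℕ → Ω → ℝ} (hindep : iIndepFun X P)
    (hident : ∀ i, IdentDistrib (X i) (X 0) P P) (h0 : P[X 0] = 0) (h1 : P[X 0 ^ 2] = 1)
    {a : ℕ → ℕ → ℝ} {b : ℕ → ℝ} (hb : Tendsto b atTop (𝓝 0))
    (hab : ∀ᶠ n in atTop, ∀ k ∈ Finset.range n, |a n k| ≤ b n)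
    (ha : Tendsto (fun n => ∑ k ∈ Finset.range n, a n k ^ 2) atTop (𝓝 1)) :
    TendstoInDistribution (fun (n : ℕ) ω => ∑ k ∈ Finset.range n, a n k * X k ω) atTop (id : ℝ → ℝ)
      (fun _ => P) (gaussianReal 0 1) where
  forall_aemeasurable n := Finset.aemeasurable_fun_sum _ fun k _ =>
    ((hident k).aemeasurable_fst).const_mul _
  tendsto := by
    have hX k := (hident k).aemeasurable_fst
    refine ProbabilityMeasure.tendsto_iff_tendsto_charFun.2 fun t => ?_
    rw! [Measure.map_id]
    have hchar : ∀ n : ℕ, charFun (P.map fun ω => ∑ k ∈ Finset.range n, a n k * X k ω) t =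
        ∏ k ∈ Finset.range n, charFun (P.map (X 0)) (a n k * t) := by
      intro n
      have hi : iIndepFun (fun k ω => a n k * X k ω) P :=
        hindep.comp (fun k x => a n k * x) (by fun_prop)
      rw [(hi.restrict _).charFun_map_fun_finsetSum_eq_prod (fun k _ => (hX k).const_mul _),
        Finset.prod_apply]
      refine Finset.prod_congr rfl fun k _ => ?_
      rw [charFun_map_mul_comp (hX k), (hident k).map_eq]
    have hprod : ∀ n : ℕ, ∏ k ∈ Finset.range n, Complex.exp (-((a n k * t : ℝ) : ℂ) ^ 2 / 2) =
        Complex.exp (-((∑ k ∈ Finset.range n, a n k ^ 2 : ℝ) : ℂ) * t ^ 2 / 2) := by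
      intro n
      rw [← Complex.exp_sum]
      congr 1
      push_cast
      rw [← Finset.sum_neg_distrib, Finset.sum_mul, Finset.sum_div]
      exact Finset.sum_congr rfl fun k _ => by ring
    have hlim : Tendsto (fun n : ℕ => Complex.exp
        (-((∑ k ∈ Finset.range n, a n k ^ 2 : ℝ) : ℂ) * t ^ 2 / 2)) atTop
        (𝓝 (Complex.exp (-((1 : ℝ) : ℂ) * t ^ 2 / 2))) := by
      have hc : Continuous fun x : ℝ => Complex.exp (-(x : ℂ) * t ^ 2 / 2) := by fun_prop
      exact (hc.tendsto 1).comp ha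
    have : IsProbabilityMeasure (P.map (X 0)) := Measure.isProbabilityMeasure_map (hX 0)
    -- Replace the factors one by one by Gaussian ones. Negligibility of the weights puts all
    -- arguments `a n k * t` in the range where the `o(t²)` estimate holds.
    have hdiff : Tendsto (fun n : ℕ => ∏ k ∈ Finset.range n, charFun (P.map (X 0)) (a n k * t) -
        ∏ k ∈ Finset.range n, Complex.exp (-((a n k * t : ℝ) : ℂ) ^ 2 / 2)) atTop (𝓝 0) := by
      rw [Metric.tendsto_atTop']
      intro ε hε
      -- The sum of squared weights is eventually below 2 and `t² / (2 (t² + 1)) < 1/2`, so this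
      -- constant makes the total error less than `ε`.
      have hε' : 0 < ε / (2 * (t ^ 2 + 1)) := by positivity
      obtain ⟨δ, hδ, hsmall⟩ := Metric.eventually_nhds_iff.1
        ((isLittleO_charFun_sub_exp (hX 0) h0 h1).bound hε')
      have hbt : Tendsto (fun n => b n * |t|) atTop (𝓝 0) := by simpa using hb.mul_const |t|
      have hev : ∀ᶠ n in atTop, ‖∏ k ∈ Finset.range n, charFun (P.map (X 0)) (a n k * t) -
          ∏ k ∈ Finset.range n, Complex.exp (-((a n k * t : ℝ) : ℂ) ^ 2 / 2)‖ < ε := by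
        filter_upwards [hab, hbt.eventually (gt_mem_nhds hδ), ha.eventually (gt_mem_nhds
          (show (1 : ℝ) < 2 by norm_num))] with n hn1 hn2 hn3
        have hgauss : ∀ x : ℝ, ‖Complex.exp (-(x : ℂ) ^ 2 / 2)‖ ≤ 1 := by
          intro x
          rw [Complex.norm_exp]
          have : (-(x : ℂ) ^ 2 / 2).re = -x ^ 2 / 2 := by
            rw [show (-(x : ℂ) ^ 2 / 2) = ((-x ^ 2 / 2 : ℝ) : ℂ) by push_cast; ring,
              Complex.ofReal_re]
          rw [this]
          exact Real.exp_le_one_iff.2 (by nlinarith [sq_nonneg x])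
        calc _ ≤ _ := norm_prod_sub_prod_le _ _ _ (fun k => norm_charFun_le_one _) fun k => hgauss _
          _ ≤ ∑ k ∈ Finset.range n, ε / (2 * (t ^ 2 + 1)) * (a n k ^ 2 * t ^ 2) := by
            refine Finset.sum_le_sum fun k hk => ?_
            have hd : dist (a n k * t) 0 < δ := by
              rw [Real.dist_eq, sub_zero, abs_mul]
              exact (mul_le_mul_of_nonneg_right (hn1 k hk) (abs_nonneg t)).trans_lt hn2
            have := hsmall hd
            rwa [Real.norm_of_nonneg (sq_nonneg _), mul_pow] at this
          _ = ε * ((∑ k ∈ Finset.range n, a n k ^ 2) * (t ^ 2 / (2 * (t ^ 2 + 1)))) := by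
            rw [← Finset.mul_sum, ← Finset.sum_mul]
            ring
          _ < ε * 1 := by
            gcongr
            have h4 : t ^ 2 / (2 * (t ^ 2 + 1)) < 1 / 2 := by
              rw [div_lt_div_iff₀ (by positivity) (by positivity)]
              linarith
            have h5 : 0 ≤ t ^ 2 / (2 * (t ^ 2 + 1)) := by positivity
            nlinarith
          _ = ε := mul_one ε
      obtain ⟨N, hN⟩ := eventually_atTop.1 hev
      exact ⟨N, fun n hn => by simpa [dist_zero_right] using hN n hn.le⟩
    simp_rw [hprod] at hdiff
    have := hdiff.add hlim
    simpa [hchar, charFun_gaussianReal, neg_div] using this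

end CentralLimit

/-! ### Asymptotics of the logarithmic design -/

section Design

lemma logState_nonneg (k : ℕ) : 0 ≤ logState k :=
  Real.log_nonneg (by linarith [(Nat.cast_nonneg k : (0 : ℝ) ≤ k)])

lemma logState_le_log {n k : ℕ} (hk : k < n) : logState k ≤ Real.log n :=
  Real.log_le_log (by positivity) (by exact_mod_cast hk)

lemma logMean_nonneg (n : ℕ) : 0 ≤ logMean n :=
  div_nonneg (Finset.sum_nonneg fun k _ => logState_nonneg k) (Nat.cast_nonneg n)

lemma logMean_le_log {n : ℕ} (hn : 0 < n) : logMean n ≤ Real.log n := by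
  have hn' : (0 : ℝ) < n := by exact_mod_cast hn
  rw [logMean, div_le_iff₀ hn']
  calc _ ≤ ∑ _k ∈ Finset.range n, Real.log n :=
        Finset.sum_le_sum fun k hk => logState_le_log (Finset.mem_range.1 hk)
    _ = _ := by simp [mul_comm]

lemma abs_logState_sub_logMean_le {n k : ℕ} (hk : k < n) :
    |logState k - logMean n| ≤ Real.log n := by
  have h1 := logState_nonneg k
  have h2 := logState_le_log hk
  have h3 := logMean_nonneg n
  have h4 := logMean_le_log (Nat.zero_lt_of_lt hk)
  rw [abs_le]
  constructor <;> linarith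

lemma sum_logState (n : ℕ) : ∑ k ∈ Finset.range n, logState k = Real.log n.factorial := by
  induction n with
  | zero => simp
  | succ n ih =>
    rw [Finset.sum_range_succ, ih, Nat.factorial_succ, Nat.cast_mul, Real.log_mul
      (by positivity) (by positivity), logState]
    push_cast
    ring

/-- The logarithm of `n^n / n! ≤ e^n`. -/
lemma log_sub_one_le_logMean {n : ℕ} (hn : 0 < n) : Real.log n - 1 ≤ logMean n := by
  have hn' : (0 : ℝ) < n := by exact_mod_cast hn
  rw [logMean, sum_logState, le_div_iff₀ hn']
  have h := Real.pow_div_factorial_le_exp (n : ℝ) hn'.le n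
  have h2 := Real.log_le_log (by positivity) h
  rw [Real.log_exp, Real.log_div (by positivity) (by positivity), Real.log_pow] at h2
  linarith

lemma sum_logState_sub_logMean (n : ℕ) : ∑ k ∈ Finset.range n, (logState k - logMean n) = 0 := by
  rcases Nat.eq_zero_or_pos n with rfl | hn
  · simp
  · have hn' : (n : ℝ) ≠ 0 := by positivity
    rw [Finset.sum_sub_distrib, Finset.sum_const, Finset.card_range, nsmul_eq_mul, logMean]
    field_simp
    simp

lemma logSS_le_sum_sq_sub (n : ℕ) (c : ℝ) :
    logSS n ≤ ∑ k ∈ Finset.range n, (logState k - c) ^ 2 := by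
  have h : ∑ k ∈ Finset.range n, (logState k - c) ^ 2 = logSS n +
      2 * (logMean n - c) * ∑ k ∈ Finset.range n, (logState k - logMean n) +
        ∑ _k ∈ Finset.range n, (logMean n - c) ^ 2 := by
    rw [logSS, Finset.mul_sum, ← Finset.sum_add_distrib, ← Finset.sum_add_distrib]
    exact Finset.sum_congr rfl fun k _ => by ring
  rw [h, sum_logState_sub_logMean, mul_zero, add_zero]
  exact le_add_of_nonneg_right (Finset.sum_nonneg fun _ _ => sq_nonneg _)

lemma sum_inv_sqrt_le (n : ℕ) :
    ∑ k ∈ Finset.range n, (Real.sqrt ((k : ℝ) + 1))⁻¹ ≤ 2 * Real.sqrt n := by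
  induction n with
  | zero => simp
  | succ n ih =>
    rw [Finset.sum_range_succ]
    push_cast
    have h1 : 0 < Real.sqrt ((n : ℝ) + 1) := Real.sqrt_pos.2 (by positivity)
    have h2 := Real.sqrt_nonneg (n : ℝ)
    have h3 := Real.sq_sqrt (show (0 : ℝ) ≤ (n : ℝ) + 1 by positivity)
    have h4 := Real.sq_sqrt (show (0 : ℝ) ≤ (n : ℝ) by positivity)
    have h5 : (Real.sqrt ((n : ℝ) + 1))⁻¹ ≤ 2 * Real.sqrt ((n : ℝ) + 1) - 2 * Real.sqrt n := by
      rw [inv_eq_one_div, div_le_iff₀ h1]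
      nlinarith [sq_nonneg (Real.sqrt ((n : ℝ) + 1) - Real.sqrt n)]
    linarith

lemma log_sq_le_mul_sqrt {x : ℝ} (hx : 1 ≤ x) : Real.log x ^ 2 ≤ 16 * Real.sqrt x := by
  have h0 : 0 ≤ Real.log x := Real.log_nonneg hx
  have h := Real.log_le_rpow_div (zero_le_one.trans hx) (show (0 : ℝ) < 1 / 4 by norm_num)
  have h1 : (x ^ (1 / 4 : ℝ)) ^ 2 = Real.sqrt x := by
    rw [← Real.rpow_natCast, ← Real.rpow_mul (zero_le_one.trans hx), Real.sqrt_eq_rpow]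
    norm_num
  calc Real.log x ^ 2 ≤ (x ^ (1 / 4 : ℝ) / (1 / 4)) ^ 2 := pow_le_pow_left₀ h0 h 2
    _ = _ := by rw [div_pow, h1]; ring

/-- Deviations may be taken from `ln n` instead of the mean, as the mean minimizes the sum of
squares. They become logarithms of ratios `n / (k+1)`, whose squares are at most 16 times the square
root of the ratio, and the sum of `1/√(k+1)` is at most `2√n`. -/
lemma logSS_le (n : ℕ) : logSS n ≤ 32 * n := by
  refine (logSS_le_sum_sq_sub n (Real.log n)).trans ?_
  calc _ ≤ ∑ k ∈ Finset.range n, 16 * Real.sqrt n * (Real.sqrt ((k : ℝ) + 1))⁻¹ := by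
        refine Finset.sum_le_sum fun k hk => ?_
        have hk' : (k : ℝ) + 1 ≤ n := by exact_mod_cast Finset.mem_range.1 hk
        have hk0 : (0 : ℝ) < (k : ℝ) + 1 := by positivity
        have h := log_sq_le_mul_sqrt ((one_le_div hk0).2 hk')
        rw [Real.log_div (by linarith) hk0.ne', Real.sqrt_div (by linarith)] at h
        rw [logState, ← neg_sub, neg_sq]
        calc _ ≤ _ := h
          _ = _ := by ring
    _ = 16 * Real.sqrt n * ∑ k ∈ Finset.range n, (Real.sqrt ((k : ℝ) + 1))⁻¹ := by
        rw [Finset.mul_sum]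
    _ ≤ 16 * Real.sqrt n * (2 * Real.sqrt n) := by
        gcongr
        exact sum_inv_sqrt_le n
    _ = 32 * (Real.sqrt n * Real.sqrt n) := by ring
    _ = 32 * n := by rw [Real.mul_self_sqrt (Nat.cast_nonneg n)]

/-- Pair each state with its double, which has index `2 * j + 1` because index `j` stands for state
`j + 1`. The two logarithms differ by `ln 2`, so whatever the mean, their squared deviations add up
to at least `(ln 2)² / 2`. The two families of indices overlap, hence each is bounded by `logSS n`
separately. -/
lemma le_logSS {n : ℕ} (hn : 2 ≤ n) : (n : ℝ) / 40 ≤ logSS n := by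
  set m := n / 2 with hm
  set f : ℕ → ℝ := fun k => (logState k - logMean n) ^ 2 with hf
  have hf0 : ∀ k, 0 ≤ f k := fun k => sq_nonneg _
  have h1 : ∑ j ∈ Finset.range m, f j ≤ logSS n :=
    Finset.sum_le_sum_of_subset_of_nonneg (Finset.range_mono (by omega)) fun k _ _ => hf0 k
  have h2 : ∑ j ∈ Finset.range m, f (2 * j + 1) ≤ logSS n := by
    rw [← Finset.sum_image (s := Finset.range m) (g := fun j => 2 * j + 1) (f := f)
      (fun a _ b _ h => by simpa using h)]
    refine Finset.sum_le_sum_of_subset_of_nonneg (fun k hk => ?_) fun k _ _ => hf0 k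
    simp only [Finset.mem_image, Finset.mem_range] at hk ⊢
    omega
  have h3 : ∀ j ∈ Finset.range m, Real.log 2 ^ 2 / 2 ≤ f j + f (2 * j + 1) := by
    intro j _
    have : logState (2 * j + 1) = Real.log 2 + logState j := by
      rw [logState, logState, ← Real.log_mul (by norm_num) (by positivity)]
      push_cast
      ring_nf
    simp only [hf, this]
    nlinarith [sq_nonneg ((logState j - logMean n) * 2 + Real.log 2)]
  have h4 := Finset.sum_le_sum h3
  rw [Finset.sum_const, Finset.card_range, nsmul_eq_mul, Finset.sum_add_distrib] at h4
  have h5 : (n : ℝ) ≤ 3 * m := by exact_mod_cast (by omega : n ≤ 3 * m)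
  have h7 : (0.4 : ℝ) ≤ Real.log 2 ^ 2 := by nlinarith [Real.log_two_gt_d9]
  have h8 : (m : ℝ) * (0.4 / 2) ≤ m * (Real.log 2 ^ 2 / 2) := by gcongr
  linarith

lemma logSS_pos {n : ℕ} (hn : 2 ≤ n) : 0 < logSS n := by
  have : (0 : ℝ) < n := by positivity
  linarith [le_logSS hn]

/-- The coefficient of the `k`-th observation in the least squares estimator of the intercept. -/
def interceptWeight (n k : ℕ) : ℝ := 1 / n - logMean n / logSS n * (logState k - logMean n)

/-- The sum of the squares of the coefficients of the least squares estimator of the intercept. -/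
def interceptWeightSS (n : ℕ) : ℝ := 1 / n + logMean n ^ 2 / logSS n

lemma sum_interceptWeight_sq {n : ℕ} (hn : 2 ≤ n) :
    ∑ k ∈ Finset.range n, interceptWeight n k ^ 2 = interceptWeightSS n := by
  have hn' : (n : ℝ) ≠ 0 := by positivity
  have hs := (logSS_pos hn).ne'
  have h : ∑ k ∈ Finset.range n, interceptWeight n k ^ 2 =
      ∑ _k ∈ Finset.range n, (1 / n : ℝ) ^ 2 - 2 / n * (logMean n / logSS n) *
        ∑ k ∈ Finset.range n, (logState k - logMean n) +
        (logMean n / logSS n) ^ 2 * logSS n := by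
    nth_rw 3 [logSS]
    rw [Finset.mul_sum, Finset.mul_sum, ← Finset.sum_sub_distrib, ← Finset.sum_add_distrib]
    refine Finset.sum_congr rfl fun k _ => ?_
    rw [interceptWeight]
    ring
  rw [h, sum_logState_sub_logMean, Finset.sum_const, Finset.card_range, nsmul_eq_mul,
    interceptWeightSS]
  field_simp
  ring

lemma interceptWeightSS_pos {n : ℕ} (hn : 2 ≤ n) : 0 < interceptWeightSS n := by
  have := logSS_pos hn
  rw [interceptWeightSS]
  positivity

lemma interceptWeightSS_le {n : ℕ} (hn : 2 ≤ n) :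
    interceptWeightSS n ≤ 1 / n + 40 * (Real.log n ^ 2 / n) := by
  have hn' : (0 : ℝ) < n := by positivity
  have h1 := le_logSS hn
  have h2 : logMean n ^ 2 ≤ Real.log n ^ 2 :=
    pow_le_pow_left₀ (logMean_nonneg n) (logMean_le_log (by omega)) 2
  rw [interceptWeightSS]
  gcongr
  calc logMean n ^ 2 / logSS n ≤ Real.log n ^ 2 / (n / 40) := by gcongr
    _ = _ := by field_simp

lemma tendsto_log_sq_div : Tendsto (fun n : ℕ => Real.log n ^ 2 / n) atTop (𝓝 0) := by
  have := (Real.isLittleO_pow_log_id_atTop (n := 2)).tendsto_div_nhds_zero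
  exact this.comp tendsto_natCast_atTop_atTop

lemma tendsto_interceptWeightSS : Tendsto interceptWeightSS atTop (𝓝 0) := by
  have h : Tendsto (fun n : ℕ => (1 : ℝ) / n + 40 * (Real.log n ^ 2 / n)) atTop (𝓝 0) := by
    simpa using tendsto_one_div_atTop_nhds_zero_nat.add (tendsto_log_sq_div.const_mul 40)
  refine squeeze_zero' ?_ ?_ h
  · filter_upwards [eventually_ge_atTop 2] with n hn using (interceptWeightSS_pos hn).le
  · filter_upwards [eventually_ge_atTop 2] with n hn using interceptWeightSS_le hn

/-- The quantity is at least `(ln n - 1)² / 32`. This divergence makes the intercept error dominate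
all the others. -/
lemma tendsto_mul_interceptWeightSS :
    Tendsto (fun n : ℕ => n * interceptWeightSS n) atTop atTop := by
  have hlog : Tendsto (fun n : ℕ => Real.log n - 1) atTop atTop :=
    tendsto_atTop_add_const_right _ _ (Real.tendsto_log_atTop.comp tendsto_natCast_atTop_atTop)
  have hsq : Tendsto (fun n : ℕ => (Real.log n - 1) ^ 2 / 32) atTop atTop :=
    ((tendsto_pow_atTop two_ne_zero).comp hlog).atTop_div_const (by norm_num)
  refine tendsto_atTop_mono' _ ?_ hsq
  filter_upwards [eventually_ge_atTop 2, hlog.eventually_ge_atTop 0] with n hn h0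
  have hn' : (0 : ℝ) < n := by positivity
  have hs := logSS_pos hn
  have h1 : (Real.log n - 1) ^ 2 ≤ logMean n ^ 2 :=
    pow_le_pow_left₀ h0 (log_sub_one_le_logMean (by omega)) 2
  rw [interceptWeightSS]
  calc (Real.log n - 1) ^ 2 / 32 ≤ logMean n ^ 2 / 32 := by gcongr
    _ = n * (logMean n ^ 2 / (32 * n)) := by field_simp
    _ ≤ n * (1 / n + logMean n ^ 2 / logSS n) := by
      gcongr
      have : logMean n ^ 2 / (32 * n) ≤ logMean n ^ 2 / logSS n := by
        gcongr
        exact logSS_le n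
      have h4 : (0 : ℝ) ≤ 1 / n := by positivity
      linarith

/-- Each of the two terms bounding the weight is a product of two factors, one at most
`√(interceptWeightSS n)` and the other tending to 0 uniformly in `k`. This is the negligibility
hypothesis of the central limit theorem. -/
lemma abs_interceptWeight_div_le {n k : ℕ} (hn : 2 ≤ n) (hk : k < n) :
    |interceptWeight n k / Real.sqrt (interceptWeightSS n)| ≤
      Real.sqrt (1 / n) + Real.sqrt (40 * (Real.log n ^ 2 / n)) := by
  have hn' : (0 : ℝ) < n := by positivity
  have hs := logSS_pos hn
  have hQ := interceptWeightSS_pos hn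
  have hL := logMean_nonneg n
  have hl : 0 ≤ Real.log n := Real.log_natCast_nonneg n
  have h1 : Real.sqrt (1 / n) ≤ Real.sqrt (interceptWeightSS n) :=
    Real.sqrt_le_sqrt (le_add_of_nonneg_right (by positivity))
  have h2 : logMean n / Real.sqrt (logSS n) ≤ Real.sqrt (interceptWeightSS n) := by
    rw [← Real.sqrt_sq hL, ← Real.sqrt_div (sq_nonneg _)]
    exact Real.sqrt_le_sqrt (le_add_of_nonneg_left (by positivity))
  have h3 : Real.log n / Real.sqrt (logSS n) ≤ Real.sqrt (40 * (Real.log n ^ 2 / n)) := by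
    nth_rw 1 [← Real.sqrt_sq hl]
    rw [← Real.sqrt_div (sq_nonneg _)]
    refine Real.sqrt_le_sqrt ?_
    rw [div_le_iff₀ hs]
    have := mul_le_mul_of_nonneg_left (le_logSS hn)
      (show 0 ≤ 40 * (Real.log n ^ 2 / n) by positivity)
    calc _ = 40 * (Real.log n ^ 2 / n) * (n / 40) := by field_simp
      _ ≤ _ := this
  rw [abs_div, abs_of_nonneg (Real.sqrt_nonneg _), div_le_iff₀ (Real.sqrt_pos.2 hQ)]
  have hss : 0 < Real.sqrt (logSS n) := Real.sqrt_pos.2 hs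
  calc |interceptWeight n k| ≤ |(1 / n : ℝ)| + |logMean n / logSS n * (logState k - logMean n)| :=
        abs_sub _ _
    _ ≤ 1 / n + logMean n / logSS n * Real.log n := by
      rw [abs_mul, abs_of_nonneg (by positivity : (0 : ℝ) ≤ 1 / n),
        abs_of_nonneg (by positivity : 0 ≤ logMean n / logSS n)]
      gcongr
      exact abs_logState_sub_logMean_le hk
    _ = Real.sqrt (1 / n) * Real.sqrt (1 / n) +
        Real.log n / Real.sqrt (logSS n) * (logMean n / Real.sqrt (logSS n)) := by
      rw [Real.mul_self_sqrt (by positivity), div_mul_div_comm, Real.mul_self_sqrt hs.le]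
      ring
    _ ≤ Real.sqrt (1 / n) * Real.sqrt (interceptWeightSS n) +
        Real.sqrt (40 * (Real.log n ^ 2 / n)) * Real.sqrt (interceptWeightSS n) := by
      gcongr
    _ = _ := by ring

lemma tendsto_interceptWeight_bound :
    Tendsto (fun n : ℕ => Real.sqrt (1 / n) + Real.sqrt (40 * (Real.log n ^ 2 / n))) atTop
      (𝓝 0) := by
  have h1 : Tendsto (fun n : ℕ => Real.sqrt (1 / n)) atTop (𝓝 0) := by
    simpa using (tendsto_one_div_atTop_nhds_zero_nat (𝕜 := ℝ)).sqrt
  have h2 : Tendsto (fun n : ℕ => Real.sqrt (40 * (Real.log n ^ 2 / n))) atTop (𝓝 0) := by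
    simpa using (tendsto_log_sq_div.const_mul 40).sqrt
  simpa using h1.add h2

/-- The error of the regression in the state `k + 1`, as a function of the sojourn time. -/
def regressionError (α θ : ℝ) (k : ℕ) (x : ℝ) : ℝ :=
  Real.log x - (intercept α θ - logState k / α)

/-! ### Least squares estimators in terms of the errors -/

section LeastSquares

variable {n : ℕ} (S : ℕ → ℝ) (α θ : ℝ)

lemma log_eq_add_regressionError (k : ℕ) :
    Real.log (S k) = intercept α θ - logState k / α + regressionError α θ k (S k) := by
  rw [regressionError]
  ring

lemma slopeHat_eq (hn : 2 ≤ n) :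
    slopeHat n S = -1 / α +
      (∑ k ∈ Finset.range n, (logState k - logMean n) * regressionError α θ k (S k)) / logSS n := by
  have hs := (logSS_pos hn).ne'
  have h : ∑ k ∈ Finset.range n, Real.log (S k) * (logState k - logMean n) =
      (intercept α θ - logMean n / α) * ∑ k ∈ Finset.range n, (logState k - logMean n) +
      -1 / α * logSS n +
      ∑ k ∈ Finset.range n, (logState k - logMean n) * regressionError α θ k (S k) := by
    rw [logSS, Finset.mul_sum, Finset.mul_sum, ← Finset.sum_add_distrib, ← Finset.sum_add_distrib]
    refine Finset.sum_congr rfl fun k _ => ?_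
    rw [log_eq_add_regressionError S α θ k]
    ring
  rw [slopeHat, h, sum_logState_sub_logMean, mul_zero, zero_add, add_div,
    mul_div_assoc, div_self hs, mul_one]

lemma obsMean_eq (hn : 2 ≤ n) :
    obsMean n S = intercept α θ - logMean n / α +
      (∑ k ∈ Finset.range n, regressionError α θ k (S k)) / n := by
  have hn' : (n : ℝ) ≠ 0 := by positivity
  simp_rw [obsMean, log_eq_add_regressionError S α θ, logMean]
  rw [Finset.sum_add_distrib, Finset.sum_sub_distrib, ← Finset.sum_div, Finset.sum_const,
    Finset.card_range, nsmul_eq_mul]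
  field_simp

lemma interceptHat_sub_intercept (hn : 2 ≤ n) :
    interceptHat n S - intercept α θ =
      ∑ k ∈ Finset.range n, interceptWeight n k * regressionError α θ k (S k) := by
  have h : ∑ k ∈ Finset.range n, interceptWeight n k * regressionError α θ k (S k) =
      1 / n * ∑ k ∈ Finset.range n, regressionError α θ k (S k) - logMean n / logSS n *
      ∑ k ∈ Finset.range n, (logState k - logMean n) * regressionError α θ k (S k) := by
    rw [Finset.mul_sum, Finset.mul_sum, ← Finset.sum_sub_distrib]
    refine Finset.sum_congr rfl fun k _ => ?_
    rw [interceptWeight]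
    ring
  rw [h, interceptHat, slopeHat_eq S α θ hn, obsMean_eq S α θ hn]
  ring

/-- Pythagoras: the residual vector is the error vector minus its projections on the constants and
on the centred regressor, which are orthogonal. -/
lemma sum_residual_sq (hn : 2 ≤ n) :
    ∑ k ∈ Finset.range n, residual n S k ^ 2 =
      ∑ k ∈ Finset.range n, regressionError α θ k (S k) ^ 2 -
      (∑ k ∈ Finset.range n, regressionError α θ k (S k)) ^ 2 / n -
      (∑ k ∈ Finset.range n, (logState k - logMean n) * regressionError α θ k (S k)) ^ 2 /
        logSS n := by
  have hs := (logSS_pos hn).ne'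
  have hn' : (n : ℝ) ≠ 0 := by positivity
  set A := ∑ k ∈ Finset.range n, regressionError α θ k (S k) with hA
  set W := ∑ k ∈ Finset.range n, (logState k - logMean n) * regressionError α θ k (S k) with hW
  have hres : ∀ k, residual n S k =
      regressionError α θ k (S k) - A / n - W / logSS n * (logState k - logMean n) := by
    intro k
    rw [residual, interceptHat, slopeHat_eq S α θ hn, obsMean_eq S α θ hn,
      log_eq_add_regressionError S α θ k]
    ring
  have h : ∑ k ∈ Finset.range n, residual n S k ^ 2 =
      ∑ k ∈ Finset.range n, regressionError α θ k (S k) ^ 2 - 2 * (A / n) * A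
      - 2 * (W / logSS n) * W + 2 * (A / n) * (W / logSS n) *
        ∑ k ∈ Finset.range n, (logState k - logMean n) + (W / logSS n) ^ 2 * logSS n
      + ∑ _k ∈ Finset.range n, (A / n) ^ 2 := by
    nth_rw 4 [logSS]
    nth_rw 2 [hA]
    nth_rw 2 [hW]
    simp only [Finset.mul_sum, ← Finset.sum_add_distrib, ← Finset.sum_sub_distrib]
    refine Finset.sum_congr rfl fun k _ => ?_
    rw [hres]
    ring
  rw [h, sum_logState_sub_logMean, Finset.sum_const, Finset.card_range, nsmul_eq_mul]
  field_simp
  ring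

lemma errVarHat_nonneg (hn : 2 ≤ n) : 0 ≤ errVarHat n S := by
  have : (2 : ℝ) ≤ n := by exact_mod_cast hn
  exact div_nonneg (Finset.sum_nonneg fun _ _ => sq_nonneg _) (by linarith)

end LeastSquares

end Design

/-! ### Convergence tools, second moments and the law of the errors -/

section Probability

variable {Ω : Type*} [MeasurableSpace Ω] {P : Measure Ω} [IsProbabilityMeasure P]

section ConvergenceInMeasure

lemma tendstoInMeasure_of_integral_abs_sub_le {Y : ℕ → Ω → ℝ} {c : ℝ} {B : ℕ → ℝ}
    (hY : ∀ᶠ n in atTop, Integrable (fun ω => |Y n ω - c|) P)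
    (hB : ∀ᶠ n in atTop, ∫ ω, |Y n ω - c| ∂P ≤ B n) (hlim : Tendsto B atTop (𝓝 0)) :
    TendstoInMeasure P Y atTop (fun _ => c) := by
  rw [tendstoInMeasure_iff_measureReal_norm]
  intro ε hε
  have h0 : Tendsto (fun n => B n / ε) atTop (𝓝 0) := by simpa using hlim.div_const ε
  refine squeeze_zero' (Eventually.of_forall fun _ => measureReal_nonneg) ?_ h0
  filter_upwards [hY, hB] with n h1 h2
  rw [le_div_iff₀' hε]
  exact (mul_meas_ge_le_integral_of_nonneg (ae_of_all _ fun ω => abs_nonneg _) h1 ε).trans h2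

lemma tendstoInMeasure_of_tendsto_const {E : Type*} [SeminormedAddCommGroup E] {x : ℕ → E} {c : E}
    (h : Tendsto x atTop (𝓝 c)) :
    TendstoInMeasure P (fun n _ => x n) atTop (fun _ => c) := by
  rw [tendstoInMeasure_iff_measureReal_norm]
  intro ε hε
  refine tendsto_const_nhds.congr' ?_
  filter_upwards [(tendsto_iff_norm_sub_tendsto_zero.1 h).eventually (gt_mem_nhds hε)] with n hn
  simp [not_le.2 hn]

lemma tendstoInMeasure_prodMk {E F : Type*} [SeminormedAddCommGroup E] [SeminormedAddCommGroup F]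
    {Y : ℕ → Ω → E} {Z : ℕ → Ω → F} {c : E} {d : F}
    (hY : TendstoInMeasure P Y atTop (fun _ => c)) (hZ : TendstoInMeasure P Z atTop (fun _ => d)) :
    TendstoInMeasure P (fun n ω => (Y n ω, Z n ω)) atTop (fun _ => (c, d)) := by
  rw [tendstoInMeasure_iff_measureReal_norm] at *
  intro ε hε
  refine squeeze_zero (fun _ => measureReal_nonneg) (fun n => ?_)
    (by simpa using (hY ε hε).add (hZ ε hε))
  refine (measureReal_mono ?_).trans (measureReal_union_le _ _)
  intro ω hω
  simpa [Prod.norm_def, le_max_iff] using hω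

/-- Needed because the identities for the estimators are available only for `n ≥ 2` with `lamVar`
positive. -/
lemma tendstoInDistribution_congr_eventually {E : Type*} [TopologicalSpace E] [MeasurableSpace E]
    [OpensMeasurableSpace E] {Ω' : Type*} [MeasurableSpace Ω'] {P' : Measure Ω'}
    [IsProbabilityMeasure P'] {X Y : ℕ → Ω → E} {Z : Ω' → E}
    (h : TendstoInDistribution X atTop Z (fun _ => P) P') (hXY : ∀ᶠ n in atTop, X n =ᵐ[P] Y n)
    (hY : ∀ n, AEMeasurable (Y n) P) : TendstoInDistribution Y atTop Z (fun _ => P) P' where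
  forall_aemeasurable := hY
  aemeasurable_limit := h.aemeasurable_limit
  tendsto := by
    refine h.tendsto.congr' ?_
    filter_upwards [hXY] with n hn
    exact Subtype.ext (Measure.map_congr hn)

end ConvergenceInMeasure

section SecondMoments

lemma integral_abs_sub_mean_le {Z : Ω → ℝ} (hZ : MemLp Z 2 P) :
    ∫ ω, |Z ω - P[Z]| ∂P ≤ Real.sqrt Var[Z; P] := by
  have h1 : MemLp (fun ω => |Z ω - P[Z]|) 2 P := (hZ.sub (memLp_const _)).abs
  have h2 := variance_eq_sub h1
  have h3 := variance_nonneg (fun ω => |Z ω - P[Z]|) P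
  have h4 : P[(fun ω => |Z ω - P[Z]|) ^ 2] = Var[Z; P] := by
    rw [variance_eq_integral hZ.aemeasurable]
    simp [sq_abs]
  rw [h4] at h2
  exact Real.le_sqrt_of_sq_le (by linarith)

lemma variance_sum_of_iIndepFun {Y : ℕ → Ω → ℝ} (hY : iIndepFun Y P)
    (hL : ∀ k, MemLp (Y k) 2 P) (s : Finset ℕ) :
    Var[fun ω => ∑ k ∈ s, Y k ω; P] = ∑ k ∈ s, Var[Y k; P] := by
  rw [← IndepFun.variance_sum (fun k _ => hL k) fun i _ j _ hij => hY.indepFun hij]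
  congr 1
  ext ω
  simp

lemma integral_abs_sum_sub_le {Y : ℕ → Ω → ℝ} (hY : iIndepFun Y P)
    (hL : ∀ k, MemLp (Y k) 2 P) {m v : ℝ} (hm : ∀ k, P[Y k] = m) (hv : ∀ k, Var[Y k; P] ≤ v)
    (n : ℕ) : ∫ ω, |∑ k ∈ Finset.range n, Y k ω - n * m| ∂P ≤ Real.sqrt (n * v) := by
  have hmean : P[fun ω => ∑ k ∈ Finset.range n, Y k ω] = n * m := by
    rw [integral_finsetSum _ fun k _ => (hL k).integrable one_le_two]
    simp [hm]
  have h := integral_abs_sub_mean_le (memLp_finsetSum (Finset.range n) fun k _ => hL k)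
  rw [hmean, variance_sum_of_iIndepFun hY hL] at h
  refine h.trans (Real.sqrt_le_sqrt ?_)
  calc _ ≤ ∑ _k ∈ Finset.range n, v := Finset.sum_le_sum fun k _ => hv k
    _ = _ := by simp

lemma integral_sq_weighted_sum {X : ℕ → Ω → ℝ} (hX : iIndepFun X P) (hL : ∀ k, MemLp (X k) 2 P)
    {v : ℝ} (h0 : ∀ k, P[X k] = 0) (h2 : ∀ k, P[X k ^ 2] = v) (a : ℕ → ℝ) (s : Finset ℕ) :
    ∫ ω, (∑ k ∈ s, a k * X k ω) ^ 2 ∂P = v * ∑ k ∈ s, a k ^ 2 := by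
  have hi : iIndepFun (fun k ω => a k * X k ω) P := hX.comp (fun k x => a k * x) (by fun_prop)
  have hLa : ∀ k, MemLp (fun ω => a k * X k ω) 2 P := fun k => (hL k).const_mul (a k)
  have hmean : P[fun ω => ∑ k ∈ s, a k * X k ω] = 0 := by
    rw [integral_finsetSum _ fun k _ => (hLa k).integrable one_le_two]
    refine Finset.sum_eq_zero fun k _ => ?_
    rw [integral_const_mul, h0, mul_zero]
  have h := variance_sum_of_iIndepFun hi hLa s
  rw [variance_of_integral_eq_zero (memLp_finsetSum s fun k _ => hLa k).aemeasurable hmean] at h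
  rw [h, Finset.mul_sum]
  refine Finset.sum_congr rfl fun k _ => ?_
  have := h2 k
  simp only [Pi.pow_apply] at this
  rw [variance_const_mul, variance_of_integral_eq_zero (hL k).aemeasurable (h0 k), this, mul_comm]

end SecondMoments

section Error

variable {α lam mu : ℝ} {S : ℕ → Ω → ℝ} {J : ℕ → Ω → ℕ}

lemma IsMittagLeffler.rate_one {r : ℝ} {T : Ω → ℝ} (hr : 0 < r) (hα : 0 < α)
    (h : IsMittagLeffler P T α r) : IsMittagLeffler P (fun ω => r ^ α⁻¹ * T ω) α 1 := by
  intro t ht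
  have hc : 0 < r ^ α⁻¹ := Real.rpow_pos_of_pos hr _
  have hset : {ω | t ≤ r ^ α⁻¹ * T ω} = {ω | t / r ^ α⁻¹ ≤ T ω} := by
    ext ω
    simp [div_le_iff₀' hc]
  rw [hset, h _ (div_nonneg ht hc.le), Real.div_rpow ht hc.le, Real.rpow_inv_rpow hr.le hα.ne',
    mul_div_cancel₀ _ hr.ne', one_mul]

/-- The survival function on `t ≥ 0` fixes the law, since its value at 0 already forces almost sure
nonnegativity. -/
lemma IsMittagLeffler.identDistrib {r : ℝ} {T U : Ω → ℝ} (hT : Measurable T) (hU : Measurable U)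
    (hα : 0 < α) (h : IsMittagLeffler P T α r) (h' : IsMittagLeffler P U α r) :
    IdentDistrib T U P P where
  aemeasurable_fst := hT.aemeasurable
  aemeasurable_snd := hU.aemeasurable
  map_eq := by
    have := Measure.isProbabilityMeasure_map (μ := P) hT.aemeasurable
    refine Measure.ext_of_Ici _ _ fun t => ?_
    rw [Measure.map_apply hT measurableSet_Ici, Measure.map_apply hU measurableSet_Ici]
    rcases le_or_gt 0 t with ht | ht
    · have : P.real {ω | t ≤ T ω} = P.real {ω | t ≤ U ω} := (h t ht).trans (h' t ht).symm
      exact (measureReal_eq_measureReal_iff).1 this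
    · have h1 : P (T ⁻¹' Set.Ici t) = 1 := by
        rw [prob_compl_eq_zero_iff (hT measurableSet_Ici) |>.symm]
        filter_upwards [h.ae_nonneg hT hα] with ω hω using ht.le.trans hω
      have h2 : P (U ⁻¹' Set.Ici t) = 1 := by
        rw [prob_compl_eq_zero_iff (hU measurableSet_Ici) |>.symm]
        filter_upwards [h'.ae_nonneg hU hα] with ω hω using ht.le.trans hω
      rw [h1, h2]

lemma measurable_regressionError (α θ : ℝ) (k : ℕ) : Measurable (regressionError α θ k) :=
  Real.measurable_log.sub_const _

/-- The sojourn time in the state `k + 1`, rescaled to rate one. -/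
def scaledSojourn (α θ : ℝ) (S : ℕ → Ω → ℝ) (k : ℕ) (ω : Ω) : ℝ :=
  (θ * ((k : ℝ) + 1)) ^ α⁻¹ * S k ω

lemma IsSample.isMittagLeffler_scaledSojourn (hS : IsSample P α lam mu S J) (hα : 0 < α)
    (hθ : 0 < lam + mu) (k : ℕ) : IsMittagLeffler P (scaledSojourn α (lam + mu) S k) α 1 :=
  (hS.sojourn_law k).rate_one (by positivity) hα

lemma IsSample.measurable_scaledSojourn (hS : IsSample P α lam mu S J) (k : ℕ) :
    Measurable (scaledSojourn α (lam + mu) S k) :=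
  (hS.measurable_sojourn k).const_mul _

/-- Rescaling to rate one absorbs the dependence on the state: every error is `γ` plus the logarithm
of a rate-one variable, so the errors are identically distributed. -/
lemma IsSample.regressionError_ae_eq (hS : IsSample P α lam mu S J) (hα : 0 < α)
    (hθ : 0 < lam + mu) (k : ℕ) :
    (fun ω => regressionError α (lam + mu) k (S k ω)) =ᵐ[P] fun ω =>
      Real.eulerMascheroniConstant - -Real.log (scaledSojourn α (lam + mu) S k ω) := by
  filter_upwards [(hS.isMittagLeffler_scaledSojourn hα hθ k).ae_pos (hS.measurable_scaledSojourn k)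
    hα] with ω hω
  have hr : 0 < (lam + mu) * ((k : ℝ) + 1) := by positivity
  have hc : 0 < ((lam + mu) * ((k : ℝ) + 1)) ^ α⁻¹ := Real.rpow_pos_of_pos hr _
  have hSk : 0 < S k ω := pos_of_mul_pos_right hω hc.le
  rw [scaledSojourn, Real.log_mul hc.ne' hSk.ne', Real.log_rpow hr, Real.log_mul hθ.ne'
    (by positivity), regressionError, intercept, logState]
  ring

/-- Fourth moments are required for the squared errors to have finite variance. -/
lemma IsSample.memLp_regressionError (hS : IsSample P α lam mu S J) (hα : 0 < α)
    (hθ : 0 < lam + mu) (k : ℕ) :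
    MemLp (fun ω => regressionError α (lam + mu) k (S k ω)) 4 P := by
  refine MemLp.ae_eq (hS.regressionError_ae_eq hα hθ k).symm ?_
  exact (memLp_const _).sub (memLp_of_mem_interior_integrableExpSet
    ((hS.isMittagLeffler_scaledSojourn hα hθ k).zero_mem_interior_integrableExpSet
      (hS.measurable_scaledSojourn k) hα) 4)

lemma IsSample.integral_regressionError (hS : IsSample P α lam mu S J) (hα : 0 < α)
    (hθ : 0 < lam + mu) (k : ℕ) :
    ∫ ω, regressionError α (lam + mu) k (S k ω) ∂P = 0 := by
  have hT := hS.measurable_scaledSojourn k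
  have hM := hS.isMittagLeffler_scaledSojourn hα hθ k
  have hi := integrable_of_mem_interior_integrableExpSet
    (hM.zero_mem_interior_integrableExpSet hT hα)
  rw [integral_congr_ae (hS.regressionError_ae_eq hα hθ k), integral_sub (integrable_const _) hi,
    hM.integral_neg_log hT hα]
  simp

lemma IsSample.integral_regressionError_sq (hS : IsSample P α lam mu S J) (hα : 0 < α)
    (hθ : 0 < lam + mu) (k : ℕ) :
    ∫ ω, regressionError α (lam + mu) k (S k ω) ^ 2 ∂P = errVar α := by
  have hT := hS.measurable_scaledSojourn k
  have hM := hS.isMittagLeffler_scaledSojourn hα hθ k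
  have hI := hM.zero_mem_interior_integrableExpSet hT hα
  have hi := integrable_of_mem_interior_integrableExpSet hI
  have hi2 := integrable_pow_of_mem_interior_integrableExpSet hI 2
  have : (fun ω => regressionError α (lam + mu) k (S k ω) ^ 2) =ᵐ[P] fun ω =>
      Real.eulerMascheroniConstant ^ 2 - 2 * Real.eulerMascheroniConstant *
        -Real.log (scaledSojourn α (lam + mu) S k ω) +
        (-Real.log (scaledSojourn α (lam + mu) S k ω)) ^ 2 := by
    filter_upwards [hS.regressionError_ae_eq hα hθ k] with ω hω
    rw [hω]
    ring
  rw [integral_congr_ae this, integral_add (by fun_prop) hi2,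
    integral_sub (integrable_const _) (hi.const_mul _), integral_const_mul,
    hM.integral_neg_log hT hα, hM.integral_neg_log_sq hT hα]
  simp
  ring

lemma IsSample.identDistrib_regressionError (hS : IsSample P α lam mu S J) (hα : 0 < α)
    (hθ : 0 < lam + mu) (k : ℕ) :
    IdentDistrib (fun ω => regressionError α (lam + mu) k (S k ω))
      (fun ω => regressionError α (lam + mu) 0 (S 0 ω)) P P := by
  have h := ((hS.isMittagLeffler_scaledSojourn hα hθ k).identDistrib
    (hS.measurable_scaledSojourn k) (hS.measurable_scaledSojourn 0) hα
    (hS.isMittagLeffler_scaledSojourn hα hθ 0)).comp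
    (u := fun x => Real.eulerMascheroniConstant - -Real.log x) (by fun_prop)
  exact (IdentDistrib.of_ae_eq
    ((measurable_regressionError _ _ _).comp (hS.measurable_sojourn k)).aemeasurable
      (hS.regressionError_ae_eq hα hθ k)).trans
    (h.trans (IdentDistrib.of_ae_eq
      ((measurable_regressionError _ _ _).comp (hS.measurable_sojourn 0)).aemeasurable
      (hS.regressionError_ae_eq hα hθ 0)).symm)

lemma IsSample.iIndepFun_regressionError (hS : IsSample P α lam mu S J) :
    iIndepFun (fun k ω => regressionError α (lam + mu) k (S k ω)) P :=
  hS.indep_transitions.comp (fun k x => regressionError α (lam + mu) k x.1)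
    fun k => (measurable_regressionError _ _ k).comp measurable_fst

lemma errVar_pos (hα : 0 < α) (hα1 : α ≤ 1) : 0 < errVar α := by
  have h1 : 1 ≤ 1 / α ^ 2 := (one_le_div (by positivity)).2 (pow_le_one₀ hα.le hα1)
  have h2 : 1 / (3 * α ^ 2) = 1 / α ^ 2 / 3 := by ring
  rw [errVar, h2]
  have := Real.pi_pos
  refine mul_pos (by positivity) (by linarith)

/-- The sum of the squared errors deviates from its mean by the order of `√n`. -/
lemma IsSample.integral_abs_sum_sq_sub_le (hS : IsSample P α lam mu S J) (hα : 0 < α)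
    (hθ : 0 < lam + mu) (n : ℕ) :
    ∫ ω, |∑ k ∈ Finset.range n, regressionError α (lam + mu) k (S k ω) ^ 2 - n * errVar α| ∂P ≤
      Real.sqrt (n * Var[fun ω => regressionError α (lam + mu) 0 (S 0 ω) ^ 2; P]) := by
  refine integral_abs_sum_sub_le
    (hS.iIndepFun_regressionError.comp (fun _ x => x ^ 2) (by fun_prop)) (fun k => ?_)
    (hS.integral_regressionError_sq hα hθ) (fun k => le_of_eq ?_) n
  · have := (hS.memLp_regressionError hα hθ k)
    rw [show (fun x : ℝ => x ^ 2) ∘ (fun ω => regressionError α (lam + mu) k (S k ω)) =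
      fun ω => regressionError α (lam + mu) k (S k ω) ^ 2 from rfl]
    rw [memLp_two_iff_integrable_sq (by exact (this.aestronglyMeasurable.pow 2))]
    have h4 := this.integrable_norm_pow (p := 4) (by norm_num)
    refine h4.congr (ae_of_all _ fun ω => ?_)
    simp only [Real.norm_eq_abs]
    rw [← pow_mul, Even.pow_abs (by decide)]
  · exact ((hS.identDistrib_regressionError hα hθ k).comp (u := fun x => x ^ 2)
      (by fun_prop)).variance_eq

end Error

end Probability

/-! ### L¹ rates of the estimators, and the size of the variance -/

section Bounds

variable {Ω : Type*} [MeasurableSpace Ω] {P : Measure Ω} [IsProbabilityMeasure P]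
  {α lam mu : ℝ} {S : ℕ → Ω → ℝ} {J : ℕ → Ω → ℕ}

section ErrorBounds

lemma IsSample.memLp_two_weighted_sum (hS : IsSample P α lam mu S J) (hα : 0 < α)
    (hθ : 0 < lam + mu) (a : ℕ → ℝ) (s : Finset ℕ) :
    MemLp (fun ω => ∑ k ∈ s, a k * regressionError α (lam + mu) k (S k ω)) 2 P :=
  memLp_finsetSum s fun k _ =>
    ((hS.memLp_regressionError hα hθ k).mono_exponent (by norm_num)).const_mul (a k)

lemma IsSample.integral_sq_weighted_sum (hS : IsSample P α lam mu S J) (hα : 0 < α)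
    (hθ : 0 < lam + mu) (a : ℕ → ℝ) (s : Finset ℕ) :
    ∫ ω, (∑ k ∈ s, a k * regressionError α (lam + mu) k (S k ω)) ^ 2 ∂P =
      errVar α * ∑ k ∈ s, a k ^ 2 :=
  FracBD.integral_sq_weighted_sum hS.iIndepFun_regressionError
    (fun k => (hS.memLp_regressionError hα hθ k).mono_exponent (by norm_num))
    (hS.integral_regressionError hα hθ) (hS.integral_regressionError_sq hα hθ) a s

lemma IsSample.integral_abs_interceptHat_sub_le (hS : IsSample P α lam mu S J) (hα : 0 < α)
    (hθ : 0 < lam + mu) {n : ℕ} (hn : 2 ≤ n) :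
    Integrable (fun ω => |interceptHat n (fun k => S k ω) - intercept α (lam + mu)|) P ∧
    ∫ ω, |interceptHat n (fun k => S k ω) - intercept α (lam + mu)| ∂P ≤
      Real.sqrt (errVar α * interceptWeightSS n) := by
  have hL := hS.memLp_two_weighted_sum hα hθ (interceptWeight n) (Finset.range n)
  have hmean : ∫ ω, ∑ k ∈ Finset.range n,
      interceptWeight n k * regressionError α (lam + mu) k (S k ω) ∂P = 0 := by
    rw [integral_finsetSum _ fun k _ =>
      ((hS.memLp_regressionError hα hθ k).integrable (by norm_num)).const_mul _]
    refine Finset.sum_eq_zero fun k _ => ?_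
    rw [integral_const_mul, hS.integral_regressionError hα hθ, mul_zero]
  have h := integral_abs_sub_mean_le hL
  rw [variance_of_integral_eq_zero hL.aemeasurable hmean, hS.integral_sq_weighted_sum hα hθ,
    sum_interceptWeight_sq hn, hmean] at h
  simp_rw [fun ω => interceptHat_sub_intercept (fun k => S k ω) α (lam + mu) hn]
  exact ⟨(hL.integrable one_le_two).abs, by simpa using h⟩

/-- In the term `4 * errVar α`, each of the two projections removed from the errors has mean square
`errVar α`, and the remaining `2 * errVar α` comes from dividing by `n - 2` rather than `n`. -/
lemma IsSample.integral_abs_errVarHat_sub_le (hS : IsSample P α lam mu S J) (hα : 0 < α)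
    (hα1 : α ≤ 1) (hθ : 0 < lam + mu) {n : ℕ} (hn : 3 ≤ n) :
    Integrable (fun ω => |errVarHat n (fun k => S k ω) - errVar α|) P ∧
    ∫ ω, |errVarHat n (fun k => S k ω) - errVar α| ∂P ≤
      (Real.sqrt (n * Var[fun ω => regressionError α (lam + mu) 0 (S 0 ω) ^ 2; P]) +
        4 * errVar α) / (n - 2) := by
  have hσ := errVar_pos hα hα1
  have hn3 : (3 : ℝ) ≤ n := by exact_mod_cast hn
  have hn0 : (0 : ℝ) < n := by linarith
  have hn2 : (0 : ℝ) < n - 2 := by linarith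
  have hs := logSS_pos (show 2 ≤ n by omega)
  set Q : Ω → ℝ := fun ω =>
    ∑ k ∈ Finset.range n, regressionError α (lam + mu) k (S k ω) ^ 2 - n * errVar α with hQ
  set A : Ω → ℝ := fun ω => ∑ k ∈ Finset.range n, 1 * regressionError α (lam + mu) k (S k ω) with hA
  set W : Ω → ℝ := fun ω => ∑ k ∈ Finset.range n,
    (logState k - logMean n) * regressionError α (lam + mu) k (S k ω) with hW
  have hQi : Integrable Q P := by
    refine Integrable.sub (integrable_finsetSum _ fun k _ => ?_) (integrable_const _)
    exact ((hS.memLp_regressionError hα hθ k).mono_exponent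
      (show (2 : ENNReal) ≤ 4 by norm_num)).integrable_sq
  have hAi : Integrable (fun ω => A ω ^ 2) P :=
    (hS.memLp_two_weighted_sum hα hθ _ _).integrable_sq
  have hWi : Integrable (fun ω => W ω ^ 2) P :=
    (hS.memLp_two_weighted_sum hα hθ _ _).integrable_sq
  have hAint : ∫ ω, A ω ^ 2 ∂P = errVar α * n := by
    rw [hA, hS.integral_sq_weighted_sum hα hθ]
    simp
  have hWint : ∫ ω, W ω ^ 2 ∂P = errVar α * logSS n := by
    rw [hW, hS.integral_sq_weighted_sum hα hθ, logSS]
  have heq : ∀ ω, errVarHat n (fun k => S k ω) - errVar α =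
      (Q ω - A ω ^ 2 / n - W ω ^ 2 / logSS n + 2 * errVar α) / (n - 2) := by
    intro ω
    rw [errVarHat, sum_residual_sq (fun k => S k ω) α (lam + mu) (show 2 ≤ n by omega)]
    simp only [hQ, hA, hW, one_mul]
    rw [eq_div_iff hn2.ne', sub_mul, div_mul_cancel₀ _ hn2.ne']
    ring
  have hint : Integrable (fun ω => errVarHat n (fun k => S k ω) - errVar α) P := by
    simp_rw [heq]
    exact (((hQi.sub (hAi.div_const _)).sub (hWi.div_const _)).add (integrable_const _)).div_const _
  refine ⟨hint.abs, ?_⟩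
  have hbound : ∀ ω, |errVarHat n (fun k => S k ω) - errVar α| ≤
      (|Q ω| + A ω ^ 2 / n + W ω ^ 2 / logSS n + 2 * errVar α) / (n - 2) := by
    intro ω
    rw [heq, abs_div, abs_of_pos hn2]
    gcongr
    have h1 : 0 ≤ A ω ^ 2 / n := by positivity
    have h2 : 0 ≤ W ω ^ 2 / logSS n := by positivity
    rw [abs_le]
    constructor <;> linarith [neg_abs_le (Q ω), le_abs_self (Q ω)]
  have hI1 : Integrable (fun ω => |Q ω| + A ω ^ 2 / n) P := (hQi.abs).add (hAi.div_const _)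
  have hI2 : Integrable (fun ω => |Q ω| + A ω ^ 2 / n + W ω ^ 2 / logSS n) P :=
    hI1.add (hWi.div_const _)
  have hI3 : Integrable
      (fun ω => |Q ω| + A ω ^ 2 / n + W ω ^ 2 / logSS n + 2 * errVar α) P :=
    hI2.add (integrable_const _)
  refine (integral_mono hint.abs (hI3.div_const _) hbound).trans ?_
  rw [integral_div]
  gcongr
  rw [integral_add hI2 (integrable_const _), integral_add hI1 (hWi.div_const _),
    integral_add hQi.abs (hAi.div_const _), integral_div, integral_div, hAint, hWint,
    mul_div_cancel_right₀ _ hn0.ne', mul_div_cancel_right₀ _ hs.ne']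
  have := hS.integral_abs_sum_sq_sub_le hα hθ n
  simp only [integral_const, probReal_univ, smul_eq_mul, one_mul]
  linarith

lemma IsSample.integral_abs_pHat_sub_le (hS : IsSample P α lam mu S J) {n : ℕ} (hn : 0 < n) :
    Integrable (fun ω => |pHat n (fun k => J k ω) - lam / (lam + mu)|) P ∧
    ∫ ω, |pHat n (fun k => J k ω) - lam / (lam + mu)| ∂P ≤ Real.sqrt n / n := by
  have hn0 : (0 : ℝ) < n := by exact_mod_cast hn
  set Y : ℕ → Ω → ℝ := fun k ω => if J k ω = k + 2 then 1 else 0 with hY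
  have hset : ∀ k, MeasurableSet {ω | J k ω = k + 2} := fun k =>
    hS.measurable_next k (measurableSet_singleton (k + 2))
  have hYm : ∀ k, Measurable (Y k) := fun k =>
    Measurable.ite (hset k) measurable_const measurable_const
  have hYb : ∀ k ω, ‖Y k ω‖ ≤ 1 := by
    intro k ω
    simp only [hY]
    split_ifs <;> simp
  have hYL : ∀ k, MemLp (Y k) 2 P := fun k =>
    MemLp.of_bound (hYm k).aestronglyMeasurable 1 (ae_of_all _ (hYb k))
  have hYi : iIndepFun Y P := by
    refine hS.indep_transitions.comp (fun k (x : ℝ × ℕ) => if x.2 = k + 2 then (1 : ℝ) else 0)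
      fun k => ?_
    exact (measurable_of_countable (fun j : ℕ => if j = k + 2 then (1 : ℝ) else 0)).comp
      measurable_snd
  have hmean : ∀ k, P[Y k] = lam / (lam + mu) := by
    intro k
    rw [← hS.birth_prob k, ← integral_indicator_one (hset k)]
    refine integral_congr_ae (ae_of_all _ fun ω => ?_)
    simp [hY, Set.indicator]
  have hvar : ∀ k, Var[Y k; P] ≤ 1 := by
    intro k
    refine (variance_le_expectation_sq (hYm k).aestronglyMeasurable).trans ?_
    calc _ ≤ ∫ _ω, (1 : ℝ) ∂P := by
          refine integral_mono (hYL k).integrable_sq (integrable_const _) fun ω => ?_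
          simp only [hY, Pi.pow_apply]
          split_ifs <;> simp
      _ = 1 := by simp
  have heq : ∀ ω, |pHat n (fun k => J k ω) - lam / (lam + mu)| =
      |∑ k ∈ Finset.range n, Y k ω - n * (lam / (lam + mu))| / n := by
    intro ω
    rw [← abs_of_pos hn0, ← abs_div, abs_of_pos hn0, sub_div, mul_div_cancel_left₀ _ hn0.ne']
    simp [pHat, births, hY]
  simp_rw [heq]
  refine ⟨((integrable_finsetSum _ fun k _ => (hYL k).integrable one_le_two).sub
    (integrable_const _)).abs.div_const _, ?_⟩
  rw [integral_div]
  gcongr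
  simpa using integral_abs_sum_sub_le hYi hYL hmean hvar n

end ErrorBounds

section AsymptoticVariance

/-- The leading coefficient of the asymptotic variance, which is
`A + leadingCoeff * (n * interceptWeightSS n)`. -/
def varLeadingCoeff (α lam : ℝ) : ℝ := lam ^ 2 * α ^ 2 * errVar α

lemma exp_intercept (hα : 0 < α) {θ : ℝ} (hθ : 0 < θ) :
    Real.exp (-(α * (intercept α θ + Real.eulerMascheroniConstant))) = θ := by
  rw [intercept, sub_add_cancel, mul_div_cancel₀ _ hα.ne', neg_neg, Real.exp_log hθ]

/-- The constant `A` collects the binomial variance and the contribution of the estimated `α`. Its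
value, and even its sign, plays no role in the limit. -/
lemma exists_lamVar_eq (hα : 0 < α) (hθ : 0 < lam + mu) :
    ∃ A : ℝ, ∀ n : ℕ,
      lamVar α lam mu n = A + varLeadingCoeff α lam * (n * interceptWeightSS n) := by
  refine ⟨(lam + mu) ^ 2 * (lam / (lam + mu)) * (1 - lam / (lam + mu)) +
    lam ^ 2 * ((intercept α (lam + mu) + Real.eulerMascheroniConstant) ^ 2 *
        (α ^ 2 * (32 - 20 * α ^ 2 - α ^ 4) / 40)), fun n => ?_⟩
  have h : Real.exp (-2 * α * (intercept α (lam + mu) + Real.eulerMascheroniConstant)) =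
      (lam + mu) ^ 2 := by
    rw [← exp_intercept hα hθ, ← Real.exp_nat_mul]
    rw [exp_intercept hα hθ]
    push_cast
    ring_nf
  have h2 : (lam / (lam + mu)) ^ 2 * (lam + mu) ^ 2 = lam ^ 2 := by
    rw [← mul_pow, div_mul_cancel₀ _ hθ.ne']
  rw [lamVar, thetaVar, h, interceptWeightSS, varLeadingCoeff, ← mul_assoc ((lam / _) ^ 2), h2]
  ring

lemma varLeadingCoeff_pos (hα : 0 < α) (hα1 : α ≤ 1) (hlam : 0 < lam) :
    0 < varLeadingCoeff α lam := by
  have := errVar_pos hα hα1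
  rw [varLeadingCoeff]
  positivity

lemma tendsto_lamVar (hα : 0 < α) (hα1 : α ≤ 1) (hlam : 0 < lam) (hθ : 0 < lam + mu) :
    Tendsto (lamVar α lam mu) atTop atTop := by
  obtain ⟨A, hA⟩ := exists_lamVar_eq hα hθ
  simp_rw [funext hA]
  exact tendsto_atTop_add_const_left _ _
    (tendsto_mul_interceptWeightSS.const_mul_atTop (varLeadingCoeff_pos hα hα1 hlam))

/-- The constant part of the variance is negligible against the divergent one. The limit is the
reciprocal of `lam * α`, the absolute derivative of the estimated intensity with respect to the
intercept, so the limiting variance is exactly 1. -/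
lemma tendsto_ratio_lamVar (hα : 0 < α) (hα1 : α ≤ 1) (hlam : 0 < lam) (hθ : 0 < lam + mu) :
    Tendsto (fun n : ℕ => Real.sqrt (errVar α * (n * interceptWeightSS n / lamVar α lam mu n)))
      atTop (𝓝 (1 / (lam * α))) := by
  obtain ⟨A, hA⟩ := exists_lamVar_eq hα hθ
  have hB := varLeadingCoeff_pos hα hα1 hlam
  have hσ := errVar_pos hα hα1
  have h1 : Tendsto (fun n : ℕ => A / (n * interceptWeightSS n) + varLeadingCoeff α lam) atTop
      (𝓝 (0 + varLeadingCoeff α lam)) :=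
    (tendsto_mul_interceptWeightSS.const_div_atTop A).add_const _
  rw [zero_add] at h1
  have h2 : Tendsto (fun n : ℕ => n * interceptWeightSS n / lamVar α lam mu n) atTop
      (𝓝 (varLeadingCoeff α lam)⁻¹) := by
    refine (h1.inv₀ hB.ne').congr' ?_
    filter_upwards [eventually_ge_atTop 2] with n hn
    have := interceptWeightSS_pos hn
    have hn0 : (0 : ℝ) < n := by positivity
    rw [hA, ← inv_div]
    field_simp
  have h3 := (h2.const_mul (errVar α)).sqrt
  have h4 : errVar α * (varLeadingCoeff α lam)⁻¹ = (1 / (lam * α)) ^ 2 := by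
    rw [varLeadingCoeff]
    field_simp
  rwa [h4, Real.sqrt_sq (by positivity)] at h3

end AsymptoticVariance

end Bounds

/-! ### Exact delta method and the limits it needs -/

section Normality

variable {Ω : Type*} [MeasurableSpace Ω] {P : Measure Ω} [IsProbabilityMeasure P]
  {α lam mu : ℝ} {S : ℕ → Ω → ℝ} {J : ℕ → Ω → ℕ}

section DeltaMethod

/-- The estimator of `α` as a function of the residual variance, extended continuously to negative
arguments. -/
def alphaOfErrVar (v : ℝ) : ℝ := (3 * (max v 0 / Real.pi ^ 2 + 1 / 6)) ^ (-(1 / 2) : ℝ)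

lemma continuous_alphaOfErrVar : Continuous alphaOfErrVar := by
  refine Continuous.rpow_const (by fun_prop) fun v => Or.inl (ne_of_gt ?_)
  have : 0 ≤ max v 0 := le_max_right _ _
  positivity

lemma differentiableAt_alphaOfErrVar {v : ℝ} (hv : 0 < v) : DifferentiableAt ℝ alphaOfErrVar v := by
  have h : DifferentiableAt ℝ (fun v : ℝ => (3 * (v / Real.pi ^ 2 + 1 / 6)) ^ (-(1 / 2) : ℝ)) v := by
    refine DifferentiableAt.rpow_const (by fun_prop) (Or.inl (ne_of_gt ?_))
    positivity
  refine h.congr_of_eventuallyEq ?_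
  filter_upwards [lt_mem_nhds hv] with w hw
  rw [alphaOfErrVar, max_eq_left hw.le]

lemma alphaOfErrVar_errVar (hα : 0 < α) (hα1 : α ≤ 1) : alphaOfErrVar (errVar α) = α := by
  have hpi := Real.pi_ne_zero
  have h : 3 * (errVar α / Real.pi ^ 2 + 1 / 6) = (α ^ 2)⁻¹ := by
    rw [errVar]
    field_simp
    ring
  rw [alphaOfErrVar, max_eq_left (errVar_pos hα hα1).le, h, Real.rpow_neg (by positivity),
    Real.inv_rpow (by positivity), inv_inv, ← Real.sqrt_eq_rpow, Real.sqrt_sq hα.le]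

lemma continuous_dslope {f : ℝ → ℝ} {a : ℝ} (hf : Continuous f) (hd : DifferentiableAt ℝ f a) :
    Continuous (dslope f a) := by
  rw [← continuousOn_univ, continuousOn_dslope Filter.univ_mem]
  exact ⟨hf.continuousOn, hd⟩

/-- A first-order expansion without remainder: continuity of `dslope` replaces every remainder
estimate of the delta method. -/
lemma eq_add_sub_mul_dslope (f : ℝ → ℝ) (a x : ℝ) : f x = f a + (x - a) * dslope f a x := by
  have := sub_smul_dslope f a x
  rw [smul_eq_mul] at this
  linarith

/-- The exponent of the estimator of `θ` as a function of the intercept and the error variance. -/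
def thetaExponent (b v : ℝ) : ℝ := -alphaOfErrVar v * (b + Real.eulerMascheroniConstant)

/-- The standardized estimator as a continuous function of the standardized error `z` of the
intercept and of quantities that converge in probability: the standardized errors `x`, `y` of
the proportion of births and of the error variance, the ratio `r` of the scales, the intercept
`b` and the error variance `v`. -/
def standardizedLamHat (α θ p : ℝ) (q : ℝ × ℝ × ℝ × ℝ × ℝ × ℝ) : ℝ :=
  match q with
  | (z, x, y, r, b, v) =>
    x * Real.exp (thetaExponent b v) +
      p * dslope Real.exp (thetaExponent (intercept α θ) (errVar α)) (thetaExponent b v) *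
        (-(y * dslope alphaOfErrVar (errVar α) v) * (b + Real.eulerMascheroniConstant) +
          α * (r * z))

lemma continuous_standardizedLamHat (hα : 0 < α) (hα1 : α ≤ 1) (θ p : ℝ) :
    Continuous (standardizedLamHat α θ p) := by
  have h1 : Continuous (dslope alphaOfErrVar (errVar α)) :=
    continuous_dslope continuous_alphaOfErrVar (differentiableAt_alphaOfErrVar (errVar_pos hα hα1))
  have h2 : Continuous (dslope Real.exp (thetaExponent (intercept α θ) (errVar α))) :=
    continuous_dslope Real.continuous_exp Real.differentiableAt_exp
  have h3 := continuous_alphaOfErrVar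
  unfold standardizedLamHat thetaExponent at *
  fun_prop

lemma exp_thetaExponent (hα : 0 < α) (hα1 : α ≤ 1) {θ : ℝ} (hθ : 0 < θ) :
    Real.exp (thetaExponent (intercept α θ) (errVar α)) = θ := by
  rw [thetaExponent, alphaOfErrVar_errVar hα hα1, neg_mul, exp_intercept hα hθ]

lemma standardizedLamHat_limit (hα : 0 < α) (hα1 : α ≤ 1) (hlam : 0 < lam) (hθ : 0 < lam + mu)
    (z : ℝ) : standardizedLamHat α (lam + mu) (lam / (lam + mu))
      (z, 0, 0, 1 / (lam * α), intercept α (lam + mu), errVar α) = z := by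
  simp only [standardizedLamHat, dslope_same, Real.deriv_exp, exp_thetaExponent hα hα1 hθ]
  field_simp
  ring

/-- Expand the product of estimators, then the exponential, then its exponent, each exactly. The
factor `c` will be `√n / √(lamVar n)`; the minus sign in `hz` compensates the decrease of the
estimator of `θ` in the intercept. -/
lemma standardizedLamHat_apply (hα : 0 < α) (hα1 : α ≤ 1) (hθ : 0 < lam + mu) {n : ℕ} (hn : 2 ≤ n)
    (s : ℕ → ℝ) (j : ℕ → ℕ) {c r z : ℝ}
    (hz : c * (interceptHat n s - intercept α (lam + mu)) = -(r * z)) :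
    standardizedLamHat α (lam + mu) (lam / (lam + mu))
      (z, c * (pHat n j - lam / (lam + mu)), c * (errVarHat n s - errVar α), r,
        interceptHat n s, errVarHat n s) = c * (lamHat n s j - lam) := by
  have ha : alphaHat n s = alphaOfErrVar (errVarHat n s) := by
    rw [alphaHat, alphaOfErrVar, max_eq_left (errVarHat_nonneg s hn)]
  have hθhat : thetaHat n s = Real.exp (thetaExponent (interceptHat n s) (errVarHat n s)) := by
    rw [thetaHat, ha, thetaExponent]
  have h1 := eq_add_sub_mul_dslope Real.exp (thetaExponent (intercept α (lam + mu)) (errVar α))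
    (thetaExponent (interceptHat n s) (errVarHat n s))
  have h2 := eq_add_sub_mul_dslope alphaOfErrVar (errVar α) (errVarHat n s)
  rw [alphaOfErrVar_errVar hα hα1] at h2
  rw [exp_thetaExponent hα hα1 hθ] at h1
  have h3 : thetaExponent (intercept α (lam + mu)) (errVar α) =
      -α * (intercept α (lam + mu) + Real.eulerMascheroniConstant) := by
    rw [thetaExponent, alphaOfErrVar_errVar hα hα1]
  have h4 : lam = lam / (lam + mu) * (lam + mu) := (div_mul_cancel₀ _ hθ.ne').symm
  have h5 : c * (lamHat n s j - lam) = c * (pHat n j - lam / (lam + mu)) * thetaHat n s +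
      lam / (lam + mu) * (c * (thetaHat n s - (lam + mu))) := by
    rw [lamHat]
    linear_combination (-c) * h4
  rw [h5, hθhat]
  simp only [standardizedLamHat]
  set D := dslope Real.exp (thetaExponent (intercept α (lam + mu)) (errVar α))
    (thetaExponent (interceptHat n s) (errVarHat n s)) with hD
  have h6 : Real.exp (thetaExponent (interceptHat n s) (errVarHat n s)) - (lam + mu) =
      (thetaExponent (interceptHat n s) (errVarHat n s) -
        thetaExponent (intercept α (lam + mu)) (errVar α)) * D := by
    linarith
  rw [h6, h3, thetaExponent]
  set H := dslope alphaOfErrVar (errVar α) (errVarHat n s) with hH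
  rw [h2]
  linear_combination (lam / (lam + mu) * D * α) * hz

end DeltaMethod

section Limits

lemma measurable_interceptHat (n : ℕ) (hS : ∀ k, Measurable (S k)) :
    Measurable fun ω => interceptHat n (fun k => S k ω) := by
  unfold interceptHat obsMean slopeHat
  fun_prop

lemma measurable_errVarHat (n : ℕ) (hS : ∀ k, Measurable (S k)) :
    Measurable fun ω => errVarHat n (fun k => S k ω) := by
  have := measurable_interceptHat n hS
  unfold errVarHat residual slopeHat
  fun_prop

lemma measurable_pHat (n : ℕ) (hJ : ∀ k, Measurable (J k)) :
    Measurable fun ω => pHat n (fun k => J k ω) := by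
  simp only [pHat, births, Finset.card_filter]
  push_cast
  refine (Finset.measurable_fun_sum _ fun k _ => ?_).div_const _
  exact (measurable_of_countable (fun j : ℕ => if j = k + 2 then (1 : ℝ) else 0)).comp (hJ k)

lemma measurable_lamHat (n : ℕ) (hS : ∀ k, Measurable (S k)) (hJ : ∀ k, Measurable (J k)) :
    Measurable fun ω => lamHat n (fun k => S k ω) (fun k => J k ω) := by
  have h1 := measurable_interceptHat n hS
  have h2 := measurable_errVarHat n hS
  have h3 := measurable_pHat n hJ
  unfold lamHat thetaHat alphaHat
  refine h3.mul (Real.measurable_exp.comp (Measurable.mul (Measurable.neg ?_) (h1.add_const _)))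
  exact (Measurable.const_mul ((h2.div_const _).add_const _) _).pow_const _

/-- The standardized error of the least squares estimator of the intercept, with sign reversed, is
asymptotically standard normal. -/
lemma IsSample.tendstoInDistribution_intercept (hS : IsSample P α lam mu S J) (hα : 0 < α)
    (hα1 : α ≤ 1) (hθ : 0 < lam + mu) :
    TendstoInDistribution (fun (n : ℕ) ω => ∑ k ∈ Finset.range n,
      -(interceptWeight n k / Real.sqrt (interceptWeightSS n)) *
        (regressionError α (lam + mu) k (S k ω) / Real.sqrt (errVar α)))
      atTop (id : ℝ → ℝ) (fun _ => P) (gaussianReal 0 1) := by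
  have hσ := errVar_pos hα hα1
  refine tendstoInDistribution_weighted_sum
    (X := fun k ω => regressionError α (lam + mu) k (S k ω) / Real.sqrt (errVar α))
    (a := fun n k => -(interceptWeight n k / Real.sqrt (interceptWeightSS n)))
    (hS.iIndepFun_regressionError.comp (fun _ x => x / Real.sqrt (errVar α)) (by fun_prop))
    (fun k => (hS.identDistrib_regressionError hα hθ k).comp
      (u := fun x => x / Real.sqrt (errVar α)) (by fun_prop)) ?_ ?_
    tendsto_interceptWeight_bound ?_ ?_
  · rw [integral_div, hS.integral_regressionError hα hθ, zero_div]
  · simp only [Pi.pow_apply, div_pow]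
    rw [integral_div, hS.integral_regressionError_sq hα hθ, Real.sq_sqrt hσ.le, div_self hσ.ne']
  · filter_upwards [eventually_ge_atTop 2] with n hn k hk
    rw [abs_neg]
    exact abs_interceptWeight_div_le hn (Finset.mem_range.1 hk)
  · refine tendsto_const_nhds.congr' ?_
    filter_upwards [eventually_ge_atTop 2] with n hn
    have hQ := interceptWeightSS_pos hn
    simp_rw [neg_sq, div_pow, Real.sq_sqrt hQ.le]
    rw [← Finset.sum_div, sum_interceptWeight_sq hn, div_self hQ.ne']

lemma IsSample.tendstoInMeasure_interceptHat (hS : IsSample P α lam mu S J) (hα : 0 < α)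
    (hθ : 0 < lam + mu) :
    TendstoInMeasure P (fun n ω => interceptHat n (fun k => S k ω)) atTop
      (fun _ => intercept α (lam + mu)) := by
  refine tendstoInMeasure_of_integral_abs_sub_le
    (B := fun n => Real.sqrt (errVar α * interceptWeightSS n)) ?_ ?_ ?_
  · filter_upwards [eventually_ge_atTop 2] with n hn
      using (hS.integral_abs_interceptHat_sub_le hα hθ hn).1
  · filter_upwards [eventually_ge_atTop 2] with n hn
      using (hS.integral_abs_interceptHat_sub_le hα hθ hn).2
  · simpa using (tendsto_interceptWeightSS.const_mul (errVar α)).sqrt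

lemma IsSample.exists_integral_abs_errVarHat_sub_le (hS : IsSample P α lam mu S J) (hα : 0 < α)
    (hα1 : α ≤ 1) (hθ : 0 < lam + mu) :
    ∃ C : ℝ, ∀ n : ℕ, 4 ≤ n →
      ∫ ω, |errVarHat n (fun k => S k ω) - errVar α| ∂P ≤ C / Real.sqrt n := by
  set κ := Var[fun ω => regressionError α (lam + mu) 0 (S 0 ω) ^ 2; P]
  refine ⟨2 * (Real.sqrt κ + 4 * errVar α), fun n hn => ?_⟩
  have hσ := errVar_pos hα hα1
  have hn4 : (4 : ℝ) ≤ n := by exact_mod_cast hn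
  have hs1 : 1 ≤ Real.sqrt n := Real.one_le_sqrt.2 (by linarith)
  have hss := Real.mul_self_sqrt (show (0 : ℝ) ≤ n by linarith)
  refine (hS.integral_abs_errVarHat_sub_le hα hα1 hθ (by omega)).2.trans ?_
  rw [Real.sqrt_mul (by linarith)]
  calc (Real.sqrt n * Real.sqrt κ + 4 * errVar α) / (n - 2)
      ≤ (Real.sqrt n * (Real.sqrt κ + 4 * errVar α)) / (n / 2) := by
        have h0 : (0 : ℝ) ≤ Real.sqrt κ := Real.sqrt_nonneg _
        gcongr
        · nlinarith
        · linarith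
    _ = 2 * (Real.sqrt κ + 4 * errVar α) / Real.sqrt n := by
        rw [div_eq_div_iff (by linarith) (by linarith)]
        linear_combination (Real.sqrt κ + 4 * errVar α) * hss

lemma IsSample.tendstoInMeasure_errVarHat (hS : IsSample P α lam mu S J) (hα : 0 < α)
    (hα1 : α ≤ 1) (hθ : 0 < lam + mu) :
    TendstoInMeasure P (fun n ω => errVarHat n (fun k => S k ω)) atTop (fun _ => errVar α) := by
  obtain ⟨C, hC⟩ := hS.exists_integral_abs_errVarHat_sub_le hα hα1 hθ
  refine tendstoInMeasure_of_integral_abs_sub_le (B := fun n => C / Real.sqrt n) ?_ ?_ ?_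
  · filter_upwards [eventually_ge_atTop 3] with n hn
      using (hS.integral_abs_errVarHat_sub_le hα hα1 hθ hn).1
  · filter_upwards [eventually_ge_atTop 4] with n hn using hC n hn
  · exact (Real.tendsto_sqrt_atTop.comp tendsto_natCast_atTop_atTop).const_div_atTop C

/-- The L¹ error is of order `1/√n`, so after scaling it is of order `1/√(lamVar n)`, which tends to
0. -/
lemma IsSample.tendstoInMeasure_scaled_errVarHat (hS : IsSample P α lam mu S J) (hα : 0 < α)
    (hα1 : α ≤ 1) (hlam : 0 < lam) (hθ : 0 < lam + mu) :
    TendstoInMeasure P (fun (n : ℕ) ω => Real.sqrt n / Real.sqrt (lamVar α lam mu n) *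
      (errVarHat n (fun k => S k ω) - errVar α)) atTop (fun _ => 0) := by
  obtain ⟨C, hC⟩ := hS.exists_integral_abs_errVarHat_sub_le hα hα1 hθ
  have habs : ∀ (n : ℕ) ω, |Real.sqrt n / Real.sqrt (lamVar α lam mu n) *
      (errVarHat n (fun k => S k ω) - errVar α) - 0| =
      Real.sqrt n / Real.sqrt (lamVar α lam mu n) *
        |errVarHat n (fun k => S k ω) - errVar α| := by
    intro n ω
    rw [sub_zero, abs_mul, abs_of_nonneg (by positivity)]
  refine tendstoInMeasure_of_integral_abs_sub_le
    (B := fun n => C / Real.sqrt (lamVar α lam mu n)) ?_ ?_ ?_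
  · filter_upwards [eventually_ge_atTop 3] with n hn
    simp_rw [habs]
    exact (hS.integral_abs_errVarHat_sub_le hα hα1 hθ hn).1.const_mul _
  · filter_upwards [eventually_ge_atTop 4] with n hn
    simp_rw [habs]
    have hn0 : 0 < Real.sqrt n := Real.sqrt_pos.2 (by positivity)
    rw [integral_const_mul]
    calc _ ≤ Real.sqrt n / Real.sqrt (lamVar α lam mu n) * (C / Real.sqrt n) := by
          gcongr
          exact hC n hn
      _ = _ := by field_simp
  · exact (Real.tendsto_sqrt_atTop.comp (tendsto_lamVar hα hα1 hlam hθ)).const_div_atTop C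

lemma IsSample.tendstoInMeasure_scaled_pHat (hS : IsSample P α lam mu S J) (hα : 0 < α)
    (hα1 : α ≤ 1) (hlam : 0 < lam) (hθ : 0 < lam + mu) :
    TendstoInMeasure P (fun (n : ℕ) ω => Real.sqrt n / Real.sqrt (lamVar α lam mu n) *
      (pHat n (fun k => J k ω) - lam / (lam + mu))) atTop (fun _ => 0) := by
  have habs : ∀ (n : ℕ) ω, |Real.sqrt n / Real.sqrt (lamVar α lam mu n) *
      (pHat n (fun k => J k ω) - lam / (lam + mu)) - 0| =
      Real.sqrt n / Real.sqrt (lamVar α lam mu n) *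
        |pHat n (fun k => J k ω) - lam / (lam + mu)| := by
    intro n ω
    rw [sub_zero, abs_mul, abs_of_nonneg (by positivity)]
  refine tendstoInMeasure_of_integral_abs_sub_le
    (B := fun n => 1 / Real.sqrt (lamVar α lam mu n)) ?_ ?_ ?_
  · filter_upwards [eventually_gt_atTop 0] with n hn
    simp_rw [habs]
    exact (hS.integral_abs_pHat_sub_le hn).1.const_mul _
  · filter_upwards [eventually_gt_atTop 0] with n hn
    simp_rw [habs]
    have hn0 : (0 : ℝ) < n := by exact_mod_cast hn
    rw [integral_const_mul]
    calc _ ≤ Real.sqrt n / Real.sqrt (lamVar α lam mu n) * (Real.sqrt n / n) := by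
          gcongr
          exact (hS.integral_abs_pHat_sub_le hn).2
      _ = Real.sqrt n * Real.sqrt n / n / Real.sqrt (lamVar α lam mu n) := by ring
      _ = _ := by rw [Real.mul_self_sqrt hn0.le, div_self hn0.ne']
  · exact (Real.tendsto_sqrt_atTop.comp (tendsto_lamVar hα hα1 hlam hθ)).const_div_atTop 1

lemma scaled_interceptHat_sub (hα : 0 < α) (hα1 : α ≤ 1) {n : ℕ} (hn : 2 ≤ n)
    (hV : 0 < lamVar α lam mu n) (s : ℕ → ℝ) :
    Real.sqrt n / Real.sqrt (lamVar α lam mu n) *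
      (interceptHat n s - intercept α (lam + mu)) =
    -(Real.sqrt (errVar α * (n * interceptWeightSS n / lamVar α lam mu n)) *
      ∑ k ∈ Finset.range n, -(interceptWeight n k / Real.sqrt (interceptWeightSS n)) *
        (regressionError α (lam + mu) k (s k) / Real.sqrt (errVar α))) := by
  have hσ := Real.sqrt_pos.2 (errVar_pos hα hα1)
  have hQ0 := interceptWeightSS_pos hn
  have hQ := Real.sqrt_pos.2 hQ0
  have hV' := Real.sqrt_pos.2 hV
  rw [interceptHat_sub_intercept s α (lam + mu) hn, Finset.mul_sum, Finset.mul_sum,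
    ← Finset.sum_neg_distrib, Real.sqrt_mul (errVar_pos hα hα1).le, Real.sqrt_div' _ hV.le,
    Real.sqrt_mul (Nat.cast_nonneg n)]
  refine Finset.sum_congr rfl fun k _ => ?_
  field_simp

end Limits

end Normality

end FracBD

end

/-! ### Conclusion by Slutsky's theorem -/

theorem mainTheorem5 {Ω : Type*} [MeasurableSpace Ω] (P : Measure Ω) [IsProbabilityMeasure P]
    (α lam mu : ℝ) (hα : 0 < α) (hα1 : α ≤ 1) (hlam : 0 < lam) (hmu : 0 < mu)
    (S : ℕ → Ω → ℝ) (J : ℕ → Ω → ℕ) (hS : FracBD.IsSample P α lam mu S J) :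
    TendstoInDistribution
      (fun (n : ℕ) (ω : Ω) =>
        Real.sqrt n * (FracBD.lamHat n (fun k => S k ω) (fun k => J k ω) - lam) /
          Real.sqrt (FracBD.lamVar α lam mu n))
      atTop (id : ℝ → ℝ) (fun _ => P) (gaussianReal 0 1) := by
  have hθ : 0 < lam + mu := add_pos hlam hmu
  have hb n := FracBD.measurable_interceptHat n hS.measurable_sojourn
  have hv n := FracBD.measurable_errVarHat n hS.measurable_sojourn
  have hp n := FracBD.measurable_pHat n hS.measurable_next
  have h1 := FracBD.tendstoInMeasure_prodMk (hS.tendstoInMeasure_interceptHat hα hθ)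
    (hS.tendstoInMeasure_errVarHat hα hα1 hθ)
  have h2 := FracBD.tendstoInMeasure_prodMk (FracBD.tendstoInMeasure_of_tendsto_const (P := P)
    (FracBD.tendsto_ratio_lamVar hα hα1 hlam hθ)) h1
  have h3 := FracBD.tendstoInMeasure_prodMk
    (hS.tendstoInMeasure_scaled_errVarHat hα hα1 hlam hθ) h2
  have hY := FracBD.tendstoInMeasure_prodMk (hS.tendstoInMeasure_scaled_pHat hα hα1 hlam hθ) h3
  have hYm : ∀ n : ℕ, AEMeasurable (fun ω =>
      (Real.sqrt n / Real.sqrt (FracBD.lamVar α lam mu n) *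
        (FracBD.pHat n (fun k => J k ω) - lam / (lam + mu)),
      Real.sqrt n / Real.sqrt (FracBD.lamVar α lam mu n) *
        (FracBD.errVarHat n (fun k => S k ω) - FracBD.errVar α),
      Real.sqrt (FracBD.errVar α * (n * FracBD.interceptWeightSS n / FracBD.lamVar α lam mu n)),
      FracBD.interceptHat n (fun k => S k ω), FracBD.errVarHat n (fun k => S k ω))) P := fun n =>
    ((((hp n).sub_const _).const_mul _).prodMk ((((hv n).sub_const _).const_mul _).prodMk
      (measurable_const.prodMk ((hb n).prodMk (hv n))))).aemeasurable
  -- Slutsky: the first coordinate converges in law and the other five in probability to constants,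
  -- at which the continuous map reduces to the identity in `z`.
  have key := TendstoInDistribution.continuous_comp_prodMk_of_tendstoInMeasure_const
    (FracBD.continuous_standardizedLamHat hα hα1 (lam + mu) (lam / (lam + mu)))
    (hS.tendstoInDistribution_intercept hα hα1 hθ) hY hYm
  simp only [id_eq, FracBD.standardizedLamHat_limit hα hα1 hlam hθ] at key
  refine FracBD.tendstoInDistribution_congr_eventually key ?_ fun n => ?_
  · filter_upwards [eventually_ge_atTop 2,
      (FracBD.tendsto_lamVar hα hα1 hlam hθ).eventually_gt_atTop 0] with n hn hV
    refine ae_of_all _ fun ω => ?_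
    simp only
    rw [FracBD.standardizedLamHat_apply hα hα1 hθ hn _ _
      (FracBD.scaled_interceptHat_sub hα hα1 hn hV _)]
    ring
  · exact ((((FracBD.measurable_lamHat n hS.measurable_sojourn hS.measurable_next).sub_const
      lam).const_mul _).div_const _).aemeasurable
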